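/- **Setting.** An unweighted instance $\Psi$ of $\mathsf{Max}\text{-}k\mathsf{AND}$ on $n$ Boolean variables is a sequence of $m \ge 1$ clauses $C_1,\dots,C_m$ (repetitions allowed), where $C_j=(V_j^+,V_j^-)$ consists of disjoint sets $V_j^+,V_j^-\subseteq[n]$ with $|V_j^+\cup V_j^-|=k$. An assignment $x\in\{\pm1\}^n$ satisfies $C_j$ if $x_v=+1$ for all $v\in V_j^+$ and $x_v=-1$ for all $v\in V_j^-$, and the value $\mathsf{val}_\Psi$ is the maximum over all assignments of the fraction of clauses that are satisfied. Let $\gamma_k=1/k$ for odd $k$ and $\gamma_k=1/(k+1)$ for even $k$, and let $$\alpha^*_k = 2^{-(k-1)}\bigl((1-\gamma_k)(1+\gamma_k)\bigr)^{\lfloor k/2\rfloor}.$$ (With $p^*_k=\frac12(1+\gamma_k)$ this is $(p^*_k(1-p^*_k))^{\lfloor k/2\rfloor}$ for odd $k$ and $2(p^*_k(1-p^*_k))^{\lfloor k/2\rfloor}$ for even $k$.) A one-pass streaming algorithm is a program for a random access machine with a read-once input stream of numbers; it is told $n$, and the clauses then arrive one after the other, each as the list of its $k$ variables with their signs. Its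 space is the maximum, over the whole run, of the total number of bits of the addresses and contents of its nonzero memory cells. **Theorem (random-order streaming algorithm).** For every $k\ge2$ there is an $\alpha>\alpha^*_k$ such that for every $\varepsilon>0$ there is a (deterministic) one-pass streaming algorithm with the following property. For every $d \in \mathbb{N}$ there is a constant $C$ such that, for every unweighted instance $\Psi$ of $\mathsf{Max}\text{-}k\mathsf{AND}$ with $n$ variables and $1\le m\le n^d$ clauses: 1. for every order of the clauses, the algorithm halts and uses at most $C\log n$ bits of space; 2. if the clauses arrive in uniformly random order, then with probability at least $99/100$ the algorithm outputs a number $\hat v$ that is an $(\alpha-\varepsilon)$-approximation to the value of $\Psi$, that is, $(\alpha-\varepsilon)\,\mathsf{val}_\Psi\le\hat v\le\mathsf{val}_\Psi$. -/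

import Mathlib

namespace MaxKAnd

/-! ### The constants `γ_k`, `p*_k`, `α*_k` -/

/-- `γ_k = 1/k` for odd `k` and `1/(k+1)` for even `k`. -/
noncomputable def gammaK (k : ℕ) : ℝ := if Odd k then 1 / (k : ℝ) else 1 / ((k : ℝ) + 1)

/-- `p*_k = (1 + γ_k) / 2`. -/
noncomputable def pStar (k : ℕ) : ℝ := (1 + gammaK k) / 2

/-- `α*_k = (p*_k (1 - p*_k)) ^ ⌊k/2⌋` for odd `k` and `2 (p*_k (1 - p*_k)) ^ ⌊k/2⌋` for even `k`. -/
noncomputable def alphaStar (k : ℕ) : ℝ :=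
  (if Odd k then 1 else 2) * (pStar k * (1 - pStar k)) ^ (k / 2)

/-- In both cases `α*_k = 2^{-(k-1)} ((1 - γ_k) (1 + γ_k)) ^ ⌊k/2⌋`. -/
theorem alphaStar_eq (k : ℕ) (hk : 1 ≤ k) :
    alphaStar k = ((1 - gammaK k) * (1 + gammaK k)) ^ (k / 2) / 2 ^ (k - 1) := by
  have h : pStar k * (1 - pStar k) = (1 - gammaK k) * (1 + gammaK k) / 2 ^ 2 := by
    unfold pStar; ring
  rcases Nat.even_or_odd' k with ⟨c, rfl | rfl⟩
  · obtain ⟨d, rfl⟩ : ∃ d, c = d + 1 := ⟨c - 1, by omega⟩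
    have hodd : ¬ Odd (2 * (d + 1)) := by simp
    have e1 : 2 * (d + 1) / 2 = d + 1 := by omega
    have e2 : 2 * (d + 1) - 1 = 2 * d + 1 := by omega
    rw [alphaStar, if_neg hodd, h, e1, e2, div_pow, ← pow_mul,
      show 2 * (d + 1) = (2 * d + 1) + 1 by ring, pow_succ (2 : ℝ) (2 * d + 1)]
    field_simp
  · have hodd : Odd (2 * c + 1) := ⟨c, rfl⟩
    have e1 : (2 * c + 1) / 2 = c := by omega
    have e2 : 2 * c + 1 - 1 = 2 * c := by omega
    rw [alphaStar, if_pos hodd, h, e1, e2, div_pow, ← pow_mul]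
    ring

/-! ### Unweighted instances of Max-kAND -/

/-- A constraint on exactly `k` of `n` Boolean variables: the variables in `pos` have to be `+1`,
those in `neg` have to be `-1`. -/
structure Clause (n k : ℕ) where
  pos : Finset (Fin n)
  neg : Finset (Fin n)
  disjoint : Disjoint pos neg
  card_eq : (pos ∪ neg).card = k

/-- The assignment `x` (`true` is `+1`, `false` is `-1`) satisfies the clause `C`. -/
def Clause.Sat {n k : ℕ} (C : Clause n k) (x : Fin n → Bool) : Prop :=
  (∀ v ∈ C.pos, x v = true) ∧ (∀ v ∈ C.neg, x v = false)

instance {n k : ℕ} (C : Clause n k) (x : Fin n → Bool) : Decidable (C.Sat x) :=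
  inferInstanceAs (Decidable (_ ∧ _))

/-- The fraction of the clauses of the unweighted instance `Ψ` (a sequence of `m` clauses, with
repetitions allowed) that the assignment `x` satisfies. -/
noncomputable def valAt {n k m : ℕ} (Ψ : Fin m → Clause n k) (x : Fin n → Bool) : ℝ :=
  ((Finset.univ.filter fun j => (Ψ j).Sat x).card : ℝ) / (m : ℝ)

/-- The value of `Ψ`: the maximum of `valAt Ψ x` over all assignments `x`. -/
noncomputable def value {n k m : ℕ} (Ψ : Fin m → Clause n k) : ℝ :=
  Finset.univ.sup' Finset.univ_nonempty (valAt Ψ)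

/-! ### One-pass streaming algorithms

A streaming algorithm is a program for a deterministic random access machine. Its memory cells are
indexed by natural numbers and hold natural numbers, and its input is a one-way stream of numbers,
each of which can be read only once, in the order of the stream. -/

/-- Programs. Write `R[i]` for the contents of the memory cell `i`. -/
inductive Prog where
  /-- do nothing -/
  | skip : Prog
  /-- first the one, then the other -/
  | seq : Prog → Prog → Prog
  /-- `R[d] := c` -/
  | const : (d c : ℕ) → Prog
  /-- `R[d] := R[a] + R[b]` -/
  | add : (d a b : ℕ) → Prog
  /-- `R[d] := max (R[a] - R[b]) 0` -/
  | sub : (d a b : ℕ) → Prog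
  /-- `R[d] := R[a] * R[b]` -/
  | mul : (d a b : ℕ) → Prog
  /-- `R[d] := ⌊R[a] / R[b]⌋`, or `0` if `R[b] = 0` -/
  | div : (d a b : ℕ) → Prog
  /-- `R[d] := R[R[a]]` -/
  | load : (d a : ℕ) → Prog
  /-- `R[R[a]] := R[b]` -/
  | store : (a b : ℕ) → Prog
  /-- remove the next number from the input stream and put it into `R[d]`; `R[d] := 0` at the end
  of the stream -/
  | read : (d : ℕ) → Prog
  /-- if `R[a] ≠ 0` then the one else the other -/
  | ite : (a : ℕ) → Prog → Prog → Prog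
  /-- as long as `R[a] ≠ 0` -/
  | loop : (a : ℕ) → Prog → Prog

/-- A configuration of the machine: what is left of the program (a control stack of subprograms of
the fixed program, of which only finitely many can occur), the memory, all but finitely many cells
of which are `0`, and the unread part of the stream. -/
structure Config where
  todo : List Prog
  mem : ℕ →₀ ℕ
  input : List ℕ

/-- One step of the machine; `none` if it has halted. -/
noncomputable def step : Config → Option Config
  | ⟨[], _, _⟩ => none
  | ⟨.skip :: K, R, w⟩ => some ⟨K, R, w⟩
  | ⟨.seq p q :: K, R, w⟩ => some ⟨p :: q :: K, R, w⟩
  | ⟨.const d c :: K, R, w⟩ => some ⟨K, R.update d c, w⟩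
  | ⟨.add d a b :: K, R, w⟩ => some ⟨K, R.update d (R a + R b), w⟩
  | ⟨.sub d a b :: K, R, w⟩ => some ⟨K, R.update d (R a - R b), w⟩
  | ⟨.mul d a b :: K, R, w⟩ => some ⟨K, R.update d (R a * R b), w⟩
  | ⟨.div d a b :: K, R, w⟩ => some ⟨K, R.update d (R a / R b), w⟩
  | ⟨.load d a :: K, R, w⟩ => some ⟨K, R.update d (R (R a)), w⟩
  | ⟨.store a b :: K, R, w⟩ => some ⟨K, R.update (R a) (R b), w⟩
  | ⟨.read d :: K, R, w⟩ => some ⟨K, R.update d (w.headD 0), w.tail⟩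
  | ⟨.ite a p q :: K, R, w⟩ => some ⟨(if R a ≠ 0 then p else q) :: K, R, w⟩
  | ⟨.loop a p :: K, R, w⟩ => some ⟨if R a ≠ 0 then p :: .loop a p :: K else K, R, w⟩

/-- The space that a configuration uses: the number of bits of the addresses and of the contents of
all the memory cells that are not `0`. -/
def Config.space (c : Config) : ℕ := c.mem.sum fun i v => Nat.size i + Nat.size v

/-- The number that a halted configuration outputs: the fraction `R[0] / R[1]`. -/
noncomputable def Config.output (c : Config) : ℝ := (c.mem 0 : ℝ) / (c.mem 1 : ℝ)

/-- The initial configuration of `P`: the memory holds only the number `n` of variables, in `R[0]`,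
and the input stream is `w`. -/
noncomputable def start (P : Prog) (n : ℕ) (w : List ℕ) : Config :=
  ⟨[P], Finsupp.single 0 n, w⟩

/-- Every configuration that occurs in the run of `P` on the stream `w` uses at most `S` bits. -/
def RunsInSpace (P : Prog) (n : ℕ) (w : List ℕ) (S : ℝ) : Prop :=
  ∀ c : Config, StateTransition.Reaches step (start P n w) c → (c.space : ℝ) ≤ S

/-- The run of `P` on the stream `w` halts and outputs `q`. -/
def HaltsWithOutput (P : Prog) (n : ℕ) (w : List ℕ) (q : ℝ) : Prop :=
  ∃ c ∈ StateTransition.eval step (start P n w), c.output = q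

/-! ### Randomly ordered streams of clauses -/

/-- The encoding of a clause in the stream: for each of its variables `v`, in increasing order, the
number of the variable (from `1` to `n`) and its sign (`1` if positive, `0` if negative). -/
def Clause.encode {n k : ℕ} (C : Clause n k) : List ℕ :=
  ((C.pos ∪ C.neg).sort (· ≤ ·)).flatMap fun v : Fin n => [(v : ℕ) + 1, if v ∈ C.pos then 1 else 0]

/-- The stream of the clauses of `Ψ` in the order given by the permutation `σ`. -/
def stream {n k m : ℕ} (Ψ : Fin m → Clause n k) (σ : Equiv.Perm (Fin m)) : List ℕ :=
  (List.ofFn fun i => Ψ (σ i)).flatMap Clause.encode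

/-- The probability of the event `E` for a uniformly random permutation of `m` things. -/
noncomputable def permProb (m : ℕ) (E : Set (Equiv.Perm (Fin m))) : ℝ :=
  (E.ncard : ℝ) / (Fintype.card (Equiv.Perm (Fin m)) : ℝ)

/-- `q` is an `r`-approximation to the number `v`. -/
def IsApprox (r v q : ℝ) : Prop := r * v ≤ q ∧ q ≤ v

end MaxKAnd

namespace MaxKAnd

/-! ### Independent rounding -/

/-! Let a variable with `a` positive and `b` negative occurrences have bias `(a - b) / (a + b)`, and
set it to true with probability `p`, `1/2` or `1 - p`, according to whether the bias is at least
`1/N`, in between, or at most `-1/N`. The expected fraction of satisfied clauses never exceeds the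
value. Two facts make it a good estimate.

It is at least `α` times the value for some `α > α*_k` (`DualFeasible.mul_value_le`,
`exists_dualFeasible`). This is linear programming duality: relative to an optimal assignment, every
variable moves credit from the clauses that contradict it to those that agree with it, with total
zero, and the ratio then follows from finitely many inequalities, one for each type of clause. For
`p = p*_k`, price `l = α*_k / k` for wrong majorities and `l / 2` for small biases, the limit `N →
∞` gives exactly `α*_k`. For `k ≥ 3` a finite `N` makes all tight inequalities strict, so the ratio
improves; `k = 2` needs a different `p`.

It is also an average over the clauses of a product that depends only on the biases of the `k`
variables of the clause. In random order the first `T` clauses are a uniform sample without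
replacement, so by Chebyshev's inequality a constant `T` suffices (`sampling`). The variables of the
sample are known from the start, so their biases can be counted exactly in the same pass
(`algorithm_run`). This takes constantly many cells with polynomially bounded contents, hence `O(log
n)` bits. -/

/-- The probability that a clause is satisfied when each variable `v` is independently set to
`true` with probability `f v`. -/
noncomputable def satProb {n k : ℕ} (f : Fin n → ℝ) (C : Clause n k) : ℝ :=
  (∏ v ∈ C.pos, f v) * ∏ v ∈ C.neg, (1 - f v)

/-- The weight of an assignment and the indicator of satisfaction both factor over the variables, so
the sum over assignments is a product of two-term sums. -/
theorem sum_weight_sat {n k : ℕ} (f : Fin n → ℝ) (C : Clause n k) :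
    ∑ x : Fin n → Bool, (∏ v, if x v then f v else 1 - f v) * (if C.Sat x then 1 else 0) =
      satProb f C := by
  classical
  have key : ∀ x : Fin n → Bool,
      (∏ v, if x v then f v else 1 - f v) * (if C.Sat x then (1 : ℝ) else 0) =
      ∏ v, ((if x v then f v else 1 - f v) *
        (if (v ∈ C.pos → x v = true) ∧ (v ∈ C.neg → x v = false) then 1 else 0)) := by
    intro x
    rw [Finset.prod_mul_distrib]
    congr 1
    suffices hiff : C.Sat x ↔ ∀ v ∈ (Finset.univ : Finset (Fin n)),
        (v ∈ C.pos → x v = true) ∧ (v ∈ C.neg → x v = false) by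
      by_cases h : C.Sat x
      · rw [if_pos h, Finset.prod_eq_one fun v hv => if_pos (hiff.mp h v hv)]
      · obtain ⟨v, hv⟩ := not_forall.mp fun h' => h (hiff.mpr h')
        rw [if_neg h, Finset.prod_eq_zero (Finset.mem_univ v) (if_neg fun h' => hv fun _ => h')]
    unfold Clause.Sat
    constructor
    · rintro ⟨h1, h2⟩ v _
      exact ⟨h1 v, h2 v⟩
    · intro h
      exact ⟨fun v => (h v (Finset.mem_univ v)).1, fun v => (h v (Finset.mem_univ v)).2⟩
  simp_rw [key]
  have := Finset.prod_univ_sum (fun _ : Fin n => (Finset.univ : Finset Bool))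
    (fun v b => ((if b = true then f v else 1 - f v) *
        (if (v ∈ C.pos → b = true) ∧ (v ∈ C.neg → b = false) then (1 : ℝ) else 0)))
  rw [Fintype.piFinset_univ] at this
  rw [← this]
  have hv : ∀ v : Fin n, (∑ b : Bool, (if b = true then f v else 1 - f v) *
        (if (v ∈ C.pos → b = true) ∧ (v ∈ C.neg → b = false) then (1 : ℝ) else 0)) =
      (if v ∈ C.pos then f v else 1) * (if v ∈ C.neg then 1 - f v else 1) := by
    intro v
    by_cases hp : v ∈ C.pos
    · have hn : v ∉ C.neg := Finset.disjoint_left.mp C.disjoint hp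
      simp [hp, hn]
    · by_cases hn : v ∈ C.neg <;> simp [hp, hn]
  simp_rw [hv]
  rw [Finset.prod_mul_distrib, satProb]
  simp [Finset.prod_ite_mem]

/-- The left side is the expectation of `valAt Ψ x` for a random `x`, which is at most the maximum.
-/
theorem mean_satProb_le_value {n k m : ℕ} (f : Fin n → ℝ) (h0 : ∀ v, 0 ≤ f v) (h1 : ∀ v, f v ≤ 1)
    (Ψ : Fin m → Clause n k) : (∑ j, satProb f (Ψ j)) / m ≤ value Ψ := by
  classical
  have hw : ∑ x : Fin n → Bool, (∏ v, if x v then f v else 1 - f v) = 1 := by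
    have := Finset.prod_univ_sum (fun _ : Fin n => (Finset.univ : Finset Bool))
      (fun v b => (if b = true then f v else 1 - f v))
    rw [Fintype.piFinset_univ] at this
    rw [← this]
    simp
  have hval : ∀ x, valAt Ψ x = (∑ j, if (Ψ j).Sat x then (1 : ℝ) else 0) / m := by
    intro x
    simp [valAt]
  have : (∑ j, satProb f (Ψ j)) / m =
      ∑ x : Fin n → Bool, (∏ v, if x v then f v else 1 - f v) * valAt Ψ x := by
    simp_rw [hval, ← sum_weight_sat f]
    rw [Finset.sum_comm, Finset.sum_div]
    refine Finset.sum_congr rfl fun x _ => ?_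
    rw [← Finset.mul_sum, mul_div_assoc]
  rw [this]
  calc _ ≤ ∑ x : Fin n → Bool, (∏ v, if x v then f v else 1 - f v) * value Ψ := by
        refine Finset.sum_le_sum fun x _ => ?_
        refine mul_le_mul_of_nonneg_left (Finset.le_sup' (valAt Ψ) (Finset.mem_univ x)) ?_
        refine Finset.prod_nonneg fun v _ => ?_
        split_ifs
        · exact h0 v
        · linarith [h1 v]
    _ = value Ψ := by rw [← Finset.sum_mul, hw, one_mul]

/-- Fair coins satisfy every clause with probability `2^{-k}`. This lower bound turns an additive
error into a multiplicative one. -/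
theorem one_div_two_pow_le_value {n k m : ℕ} (hm : 0 < m) (Ψ : Fin m → Clause n k) :
    1 / 2 ^ k ≤ value Ψ := by
  refine le_trans (le_of_eq ?_) (mean_satProb_le_value (fun _ => 1 / 2) (fun _ => by norm_num)
    (fun _ => by norm_num) Ψ)
  have : ∀ j, satProb (fun _ => 1 / 2) (Ψ j) = 1 / 2 ^ k := by
    intro j
    have hc := (Ψ j).card_eq
    rw [Finset.card_union_of_disjoint (Ψ j).disjoint] at hc
    rw [satProb, show (1 : ℝ) - 1 / 2 = 1 / 2 by norm_num, Finset.prod_const, Finset.prod_const,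
      ← pow_add, hc, one_div_pow]
  have hm' : (m : ℝ) ≠ 0 := by positivity
  simp_rw [this, Finset.sum_const, Finset.card_univ, Fintype.card_fin, nsmul_eq_mul]
  field_simp

/-! ### The oblivious rounding -/

/-- The probability of satisfying a literal that has `a` occurrences while its negation has `b`:
it is `p` for bias at least `1/N`, `1 - p` for bias at most `-1/N`, and `1/2` in between. -/
noncomputable def litProb (p : ℝ) (N a b : ℕ) : ℝ :=
  if a + b + N * b ≤ N * a then p else if a + b + N * a ≤ N * b then 1 - p else 1 / 2

/-- The variables that occur in a clause with sign `s`. -/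
def Clause.lits {n k : ℕ} (C : Clause n k) (s : Bool) : Finset (Fin n) := if s then C.pos else C.neg

/-- The number of clauses in which the variable `v` occurs with sign `s`. -/
def occ {n k m : ℕ} (Ψ : Fin m → Clause n k) (v : Fin n) (s : Bool) : ℕ :=
  (Finset.univ.filter fun j => v ∈ (Ψ j).lits s).card

/-- The probability with which the oblivious rounding sets `v` to `true`. -/
noncomputable def obl {n k m : ℕ} (p : ℝ) (N : ℕ) (Ψ : Fin m → Clause n k) (v : Fin n) : ℝ :=
  litProb p N (occ Ψ v true) (occ Ψ v false)

/-- Unless `a = b = 0`, the two threshold conditions exclude each other, and exchanging `a` and `b`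
exchanges them. -/
theorem litProb_compl {p : ℝ} {N a b : ℕ} (h : 0 < a + b) :
    1 - litProb p N a b = litProb p N b a := by
  unfold litProb
  split_ifs <;> first | omega | (norm_num)

theorem litProb_mem {p : ℝ} (h0 : 0 ≤ p) (h1 : p ≤ 1) (N a b : ℕ) :
    0 ≤ litProb p N a b ∧ litProb p N a b ≤ 1 := by
  unfold litProb
  split_ifs <;> constructor <;> linarith

theorem occ_pos {n k m : ℕ} (Ψ : Fin m → Clause n k) {j : Fin m} {v : Fin n} {s : Bool}
    (h : v ∈ (Ψ j).lits s) : 0 < occ Ψ v s :=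
  Finset.card_pos.mpr ⟨j, by simpa using h⟩

/-- A clause is satisfied with the product of the probabilities of its literals. -/
theorem satProb_obl {n k m : ℕ} (p : ℝ) (N : ℕ) (Ψ : Fin m → Clause n k) (j : Fin m) :
    satProb (obl p N Ψ) (Ψ j) = ∏ v ∈ (Ψ j).pos ∪ (Ψ j).neg,
      litProb p N (occ Ψ v (decide (v ∈ (Ψ j).pos))) (occ Ψ v (!decide (v ∈ (Ψ j).pos))) := by
  rw [Finset.prod_union (Ψ j).disjoint, satProb]
  congr 1
  · refine Finset.prod_congr rfl fun v hv => ?_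
    simp [hv, obl]
  · refine Finset.prod_congr rfl fun v hv => ?_
    have hp : v ∉ (Ψ j).pos := Finset.disjoint_right.mp (Ψ j).disjoint hv
    have : 0 < occ Ψ v false := occ_pos Ψ (j := j) (by simpa [Clause.lits] using hv)
    simp only [hp, obl, decide_false, Bool.not_false]
    exact litProb_compl (by omega)

/-! ### Weak duality -/

/-- Only the numbers `i`, `w`, `s` of literals of the three kinds matter for the lower bounds. This
reduces the analysis of a clause to the finitely many types in `DualFeasible`. -/
theorem exists_types {ι : Type*} (U : Finset ι) (pr price : ι → ℝ) {p q y₁ y₂ y₃ : ℝ}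
    (hp : 0 ≤ p) (hq : 0 ≤ q)
    (h : ∀ v ∈ U, (p ≤ pr v ∧ y₁ ≤ price v) ∨ (1 / 2 ≤ pr v ∧ y₂ ≤ price v) ∨
      (q ≤ pr v ∧ y₃ ≤ price v)) :
    ∃ i w s : ℕ, i + w + s = U.card ∧ p ^ i * (1 / 2) ^ w * q ^ s ≤ ∏ v ∈ U, pr v ∧
      i * y₁ + w * y₂ + s * y₃ ≤ ∑ v ∈ U, price v := by
  classical
  induction U using Finset.induction_on with
  | empty => exact ⟨0, 0, 0, by simp⟩
  | insert a U ha ih =>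
    obtain ⟨i, w, s, hc, hprod, hsum⟩ := ih fun v hv => h v (Finset.mem_insert_of_mem hv)
    rw [Finset.card_insert_of_notMem ha, Finset.prod_insert ha, Finset.sum_insert ha, ← hc]
    have h0 : 0 ≤ p ^ i * (1 / 2) ^ w * q ^ s := by positivity
    rcases h a (Finset.mem_insert_self a U) with ⟨h1, h2⟩ | ⟨h1, h2⟩ | ⟨h1, h2⟩
    · refine ⟨i + 1, w, s, by ring, ?_, by push_cast; linarith⟩
      calc _ = p * (p ^ i * (1 / 2) ^ w * q ^ s) := by ring
        _ ≤ _ := mul_le_mul h1 hprod h0 (hp.trans h1)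
    · refine ⟨i, w + 1, s, by ring, ?_, by push_cast; linarith⟩
      calc _ = 1 / 2 * (p ^ i * (1 / 2) ^ w * q ^ s) := by ring
        _ ≤ _ := mul_le_mul h1 hprod h0 (le_trans (by norm_num) h1)
    · refine ⟨i, w, s + 1, by ring, ?_, by push_cast; linarith⟩
      calc _ = q * (p ^ i * (1 / 2) ^ w * q ^ s) := by ring
        _ ≤ _ := mul_le_mul h1 hprod h0 (hq.trans h1)

/-- Feasibility of the dual solution with price `μ` for the variables of bias less than `1/N` and
price `l` for the variables whose majority sign is wrong, certifying the ratio `α`. -/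
structure DualFeasible (k : ℕ) (p : ℝ) (N : ℕ) (l μ α : ℝ) : Prop where
  half_le : 1 / 2 ≤ p
  le_one : p ≤ 1
  N_pos : 0 < N
  l_nonneg : 0 ≤ l
  μ_nonneg : 0 ≤ μ
  unsat : ∀ i w s : ℕ, i + w + s = k →
    i * (l * (1 - 1 / N)) + w * (μ * (1 + 1 / N)) ≤ p ^ i * (1 / 2) ^ w * (1 - p) ^ s
  sat : ∀ i w s : ℕ, i + w + s = k →
    α ≤ p ^ i * (1 / 2) ^ w * (1 - p) ^ s + w * (μ * (1 - 1 / N)) + s * (l * (1 + 1 / N))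

/-- The dual price of a variable with `a` right and `b` wrong occurrences. -/
noncomputable def dualPrice (N : ℕ) (l μ : ℝ) (a b : ℕ) : ℝ :=
  if a + b + N * b ≤ N * a then 0 else if a + b + N * a ≤ N * b then l else μ

theorem dualPrice_nonneg {N : ℕ} {l μ : ℝ} (hl : 0 ≤ l) (hμ : 0 ≤ μ) (a b : ℕ) :
    0 ≤ dualPrice N l μ a b := by
  unfold dualPrice
  split_ifs <;> first | assumption | exact le_rfl

/-- Here `a` counts the literal in question and `b` its negation. If the bias is `β = (a - b) / (a +
b)`, then `2b / (a + b) = 1 - β`. This is at least `1 - 1/N` when `β < 1/N` and at least `1 + 1/N`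
when `β ≤ -1/N`; for `β ≥ 1/N` the price is zero. -/
theorem DualFeasible.right_literal {k : ℕ} {p : ℝ} {N : ℕ} {l μ α : ℝ}
    (h : DualFeasible k p N l μ α) {a b : ℕ} (hab : 0 < a + b) :
    let y := dualPrice N l μ a b * (2 * b / (a + b))
    (p ≤ litProb p N a b ∧ 0 ≤ y) ∨ (1 / 2 ≤ litProb p N a b ∧ μ * (1 - 1 / N) ≤ y) ∨
      (1 - p ≤ litProb p N a b ∧ l * (1 + 1 / N) ≤ y) := by
  intro y
  have hN : (0 : ℝ) < N := by exact_mod_cast h.N_pos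
  have hab' : (0 : ℝ) < a + b := by exact_mod_cast hab
  by_cases h1 : a + b + N * b ≤ N * a
  · left
    simp [y, litProb, dualPrice, h1]
  · by_cases h2 : a + b + N * a ≤ N * b
    · right; right
      simp only [y, litProb, dualPrice, h1, h2, if_true, if_false]
      refine ⟨le_rfl, mul_le_mul_of_nonneg_left ?_ h.l_nonneg⟩
      have h2' : (a + b + N * a : ℝ) ≤ N * b := by exact_mod_cast h2
      rw [le_div_iff₀ hab', show (1 + 1 / (N : ℝ)) = (N + 1) / N by field_simp, div_mul_eq_mul_div,
        div_le_iff₀ hN]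
      linarith
    · right; left
      simp only [y, litProb, dualPrice, h1, h2, if_false]
      refine ⟨le_rfl, mul_le_mul_of_nonneg_left ?_ h.μ_nonneg⟩
      have h1' : (N * a : ℝ) ≤ a + b + N * b := by exact_mod_cast (not_le.mp h1).le
      rw [le_div_iff₀ hab', show (1 - 1 / (N : ℝ)) = (N - 1) / N by field_simp, div_mul_eq_mul_div,
        div_le_iff₀ hN]
      linarith

/-- In a clause that the optimal assignment violates, the right literals may be treated as the worst
kind: probability at least `1 - p` and price at least `0`. -/
theorem DualFeasible.right_literal' {k : ℕ} {p : ℝ} {N : ℕ} {l μ α : ℝ}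
    (h : DualFeasible k p N l μ α) (a b : ℕ) :
    1 - p ≤ litProb p N a b ∧ 0 ≤ dualPrice N l μ a b * (2 * b / (a + b)) := by
  refine ⟨?_, mul_nonneg (dualPrice_nonneg h.l_nonneg h.μ_nonneg a b) (by positivity)⟩
  have := h.half_le
  unfold litProb
  split_ifs <;> linarith

/-- The literal is now the one with `b` occurrences, and it pays in proportion to `2a / (a + b) = 1
+ β`. This is at most `1 - 1/N` if the majority is wrong and at most `1 + 1/N` for small bias. -/
theorem DualFeasible.wrong_literal {k : ℕ} {p : ℝ} {N : ℕ} {l μ α : ℝ}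
    (h : DualFeasible k p N l μ α) {a b : ℕ} (hab : 0 < a + b) :
    let z := -(dualPrice N l μ a b * (2 * a / (a + b)))
    (p ≤ litProb p N b a ∧ -(l * (1 - 1 / N)) ≤ z) ∨
      (1 / 2 ≤ litProb p N b a ∧ -(μ * (1 + 1 / N)) ≤ z) ∨ (1 - p ≤ litProb p N b a ∧ 0 ≤ z) := by
  intro z
  have hN : (0 : ℝ) < N := by exact_mod_cast h.N_pos
  have hab' : (0 : ℝ) < a + b := by exact_mod_cast hab
  rw [← litProb_compl hab]
  by_cases h1 : a + b + N * b ≤ N * a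
  · right; right
    simp [z, litProb, dualPrice, h1]
  · by_cases h2 : a + b + N * a ≤ N * b
    · left
      simp only [z, litProb, dualPrice, h1, h2, if_true, if_false]
      refine ⟨by linarith, neg_le_neg (mul_le_mul_of_nonneg_left ?_ h.l_nonneg)⟩
      have h2' : (a + b + N * a : ℝ) ≤ N * b := by exact_mod_cast h2
      rw [div_le_iff₀ hab', show (1 - 1 / (N : ℝ)) = (N - 1) / N by field_simp, div_mul_eq_mul_div,
        le_div_iff₀ hN]
      linarith
    · right; left
      simp only [z, litProb, dualPrice, h1, h2, if_false]
      refine ⟨by norm_num, neg_le_neg (mul_le_mul_of_nonneg_left ?_ h.μ_nonneg)⟩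
      have h1' : (N * a : ℝ) ≤ a + b + N * b := by exact_mod_cast (not_le.mp h1).le
      rw [div_le_iff₀ hab', show (1 + 1 / (N : ℝ)) = (N + 1) / N by field_simp, div_mul_eq_mul_div,
        le_div_iff₀ hN]
      linarith

theorem Clause.mem_lits_not {n k : ℕ} {C : Clause n k} {v : Fin n} {s : Bool} (h : v ∈ C.lits s) :
    v ∉ C.lits (!s) := by
  cases s
  · exact Finset.disjoint_right.mp C.disjoint h
  · exact Finset.disjoint_left.mp C.disjoint h

theorem Clause.decide_mem_pos {n k : ℕ} {C : Clause n k} {v : Fin n} {s : Bool}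
    (h : v ∈ C.lits s) : decide (v ∈ C.pos) = s := by
  have := C.mem_lits_not h
  cases s <;> simp_all [Clause.lits]

theorem Clause.mem_lits_or {n k : ℕ} {C : Clause n k} {v : Fin n} (h : v ∈ C.pos ∪ C.neg)
    (s : Bool) : v ∈ C.lits s ∨ v ∈ C.lits (!s) := by
  cases s <;> simp_all [Clause.lits, or_comm]

theorem Clause.sat_iff {n k : ℕ} {C : Clause n k} {x : Fin n → Bool} :
    C.Sat x ↔ ∀ v ∈ C.pos ∪ C.neg, v ∈ C.lits (x v) := by
  unfold Clause.Sat
  constructor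
  · rintro ⟨h1, h2⟩ v hv
    rcases Finset.mem_union.mp hv with hv | hv
    · rw [h1 v hv]; exact hv
    · rw [h2 v hv]; exact hv
  · intro h
    refine ⟨fun v hv => ?_, fun v hv => ?_⟩
    · have := C.decide_mem_pos (h v (Finset.mem_union_left _ hv))
      rw [← this]; simpa using hv
    · have := C.decide_mem_pos (h v (Finset.mem_union_right _ hv))
      rw [← this]; simpa using Finset.disjoint_right.mp C.disjoint hv

theorem sum_lits {n k m : ℕ} (Ψ : Fin m → Clause n k) (x : Fin n → Bool) (F : Fin n → ℝ) :
    ∑ j, ∑ v, (if v ∈ (Ψ j).lits (x v) then F v else 0) = ∑ v, occ Ψ v (x v) * F v := by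
  rw [Finset.sum_comm]
  refine Finset.sum_congr rfl fun v _ => ?_
  rw [← Finset.sum_filter, Finset.sum_const, nsmul_eq_mul, occ]

/-- Weak duality: a dual feasible solution certifies that the oblivious rounding achieves the
ratio `α`. -/
theorem DualFeasible.mul_value_le {n k m : ℕ} {p : ℝ} {N : ℕ} {l μ α : ℝ}
    (h : DualFeasible k p N l μ α) (Ψ : Fin m → Clause n k) :
    α * value Ψ ≤ (∑ j, satProb (obl p N Ψ) (Ψ j)) / m := by
  obtain ⟨x, -, hx⟩ := Finset.exists_mem_eq_sup' Finset.univ_nonempty (valAt Ψ)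
  have hval : value Ψ = (∑ j, if (Ψ j).Sat x then (1 : ℝ) else 0) / m := by
    rw [value, hx]; simp [valAt]
  rw [hval, ← mul_div_assoc]
  refine div_le_div_of_nonneg_right ?_ (Nat.cast_nonneg m)
  set A : Fin n → ℕ := fun v => occ Ψ v (x v) with hA
  set B : Fin n → ℕ := fun v => occ Ψ v (!x v) with hB
  set Y : Fin n → ℝ := fun v => dualPrice N l μ (A v) (B v) * (2 * B v / (A v + B v)) with hY
  set Z : Fin n → ℝ := fun v => dualPrice N l μ (A v) (B v) * (2 * A v / (A v + B v)) with hZ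
  -- A variable with dual price `y` gives `2yB / (A + B)` to each of its `A` occurrences that agree
  -- with `x`, and takes `2yA / (A + B)` from each of the `B` others. Both totals are `2yAB / (A +
  -- B)`, so the prices sum to zero.
  set price : Fin m → Fin n → ℝ := fun j v =>
    (if v ∈ (Ψ j).lits (x v) then Y v else 0) - (if v ∈ (Ψ j).lits (!x v) then Z v else 0) with hpr
  have htotal : ∑ j, ∑ v ∈ (Ψ j).pos ∪ (Ψ j).neg, price j v = 0 := by
    have h1 : ∀ j, ∑ v ∈ (Ψ j).pos ∪ (Ψ j).neg, price j v = ∑ v, price j v := by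
      intro j
      refine Finset.sum_subset (Finset.subset_univ _) fun v _ hv => ?_
      have h2 : ∀ s, v ∉ (Ψ j).lits s := by
        intro s hs
        apply hv
        cases s
        · exact Finset.mem_union_right _ hs
        · exact Finset.mem_union_left _ hs
      simp [price, h2]
    simp_rw [h1, hpr, Finset.sum_sub_distrib]
    rw [sum_lits Ψ x Y, sum_lits Ψ (fun v => !x v) Z, ← Finset.sum_sub_distrib]
    refine Finset.sum_eq_zero fun v _ => ?_
    simp only [hY, hZ, hA, hB]
    ring
  -- The local inequality: a satisfied clause has only right literals and falls under `sat`, while a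
  -- violated one may mix both kinds and falls under `unsat`.
  have hclause : ∀ j, α * (if (Ψ j).Sat x then (1 : ℝ) else 0) ≤
      satProb (obl p N Ψ) (Ψ j) + ∑ v ∈ (Ψ j).pos ∪ (Ψ j).neg, price j v := by
    intro j
    have hq : 0 ≤ 1 - p := by linarith [h.le_one]
    have hp : 0 ≤ p := by linarith [h.half_le]
    have hright : ∀ v, v ∈ (Ψ j).lits (x v) → decide (v ∈ (Ψ j).pos) = x v ∧ price j v = Y v ∧
        0 < A v + B v := by
      intro v hv
      refine ⟨(Ψ j).decide_mem_pos hv, ?_, ?_⟩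
      · simp [price, hv, (Ψ j).mem_lits_not hv]
      · have := occ_pos Ψ hv
        simp only [hA]; omega
    have hwrong : ∀ v, v ∈ (Ψ j).lits (!x v) → decide (v ∈ (Ψ j).pos) = !x v ∧
        price j v = - Z v ∧ 0 < A v + B v := by
      intro v hv
      refine ⟨(Ψ j).decide_mem_pos hv, ?_, ?_⟩
      · have := (Ψ j).mem_lits_not hv
        rw [Bool.not_not] at this
        simp [price, hv, this]
      · have := occ_pos Ψ hv
        simp only [hB]; omega
    rw [satProb_obl]
    by_cases hs : (Ψ j).Sat x
    · rw [if_pos hs, mul_one]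
      obtain ⟨i, w, s, hc, hprod, hsum⟩ := exists_types ((Ψ j).pos ∪ (Ψ j).neg)
        (fun v => litProb p N (occ Ψ v (decide (v ∈ (Ψ j).pos)))
          (occ Ψ v (!decide (v ∈ (Ψ j).pos)))) (price j) hp hq (y₁ := 0)
          (y₂ := μ * (1 - 1 / N)) (y₃ := l * (1 + 1 / N)) (by
            intro v hv
            obtain ⟨h1, h2, h3⟩ := hright v (Clause.sat_iff.mp hs v hv)
            simp only [h1, h2]
            exact h.right_literal h3)
      rw [(Ψ j).card_eq] at hc
      have := h.sat i w s hc
      linarith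
    · rw [if_neg hs, mul_zero]
      obtain ⟨i, w, s, hc, hprod, hsum⟩ := exists_types ((Ψ j).pos ∪ (Ψ j).neg)
        (fun v => litProb p N (occ Ψ v (decide (v ∈ (Ψ j).pos)))
          (occ Ψ v (!decide (v ∈ (Ψ j).pos)))) (price j) hp hq (y₁ := -(l * (1 - 1 / N)))
          (y₂ := -(μ * (1 + 1 / N))) (y₃ := 0) (by
            intro v hv
            rcases (Ψ j).mem_lits_or hv (x v) with hv | hv
            · obtain ⟨h1, h2, h3⟩ := hright v hv
              simp only [h1, h2]
              exact Or.inr (Or.inr (h.right_literal' _ _))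
            · obtain ⟨h1, h2, h3⟩ := hwrong v hv
              simp only [h1, h2, Bool.not_not]
              exact h.wrong_literal h3)
      rw [(Ψ j).card_eq] at hc
      have := h.unsat i w s hc
      linarith
  calc _ = ∑ j, α * (if (Ψ j).Sat x then (1 : ℝ) else 0) := by rw [Finset.mul_sum]
    _ ≤ _ := Finset.sum_le_sum fun j _ => hclause j
    _ = _ := by rw [Finset.sum_add_distrib, htotal, add_zero]

/-! ### Dual solutions that beat `α*_k` -/

/-- For `σ = 1 + 1/j` the sequence `i / σ^i` grows by the factor `(1 + 1/i) / σ`, which is at least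
`1` exactly for `1 ≤ i ≤ j`. So its maximum is attained at `j` and `j + 1` only. -/
theorem pow_mul_ge {j : ℕ} (hj : 0 < j) (i : ℕ) :
    (i : ℝ) * (1 + 1 / j) ^ j ≤ j * (1 + 1 / j) ^ i ∧
      (i ≠ j → i ≠ j + 1 → (i : ℝ) * (1 + 1 / j) ^ j < j * (1 + 1 / j) ^ i) := by
  have hjR : (0 : ℝ) < j := by exact_mod_cast hj
  set σ : ℝ := 1 + 1 / j with hσ
  have hσ0 : 0 < σ := by positivity
  have hpos : 0 < σ ^ j := by positivity
  rcases le_or_gt j i with h | h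
  · induction i, h using Nat.le_induction with
    | base => exact ⟨le_rfl, fun h => absurd rfl h⟩
    | succ i hi ih =>
      have hiR : (j : ℝ) ≤ i := by exact_mod_cast hi
      have e : (j : ℝ) * σ ^ (i + 1) - (i + 1 : ℕ) * σ ^ j =
          σ * (j * σ ^ i - i * σ ^ j) + ((i - j) / j) * σ ^ j := by
        have : ((i - j) / j : ℝ) = σ * i - (i + 1) := by rw [hσ]; field_simp; ring
        rw [this]; push_cast; ring
      have h1 := mul_nonneg hσ0.le (sub_nonneg.mpr ih.1)
      have h2 : 0 ≤ ((i - j) / j : ℝ) * σ ^ j := by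
        have : (0 : ℝ) ≤ i - j := by linarith
        positivity
      refine ⟨by linarith, fun _ hne => ?_⟩
      have h3 : (j : ℝ) < i := by
        have : j < i := by omega
        exact_mod_cast this
      have h4 : 0 < ((i - j) / j : ℝ) * σ ^ j := by
        have : (0 : ℝ) < i - j := by linarith
        positivity
      linarith
  -- Descending induction below `j`, with `i = j - d`.
  · have key : ∀ d : ℕ, d ≤ j → ((j - d : ℕ) : ℝ) * σ ^ j ≤ j * σ ^ (j - d) ∧
        (0 < d → ((j - d : ℕ) : ℝ) * σ ^ j < j * σ ^ (j - d)) := by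
      intro d
      induction d with
      | zero => intro _; simp
      | succ d ih =>
        intro hd
        obtain ⟨i, rfl⟩ : ∃ i, j = i + (d + 1) := ⟨j - (d + 1), by omega⟩
        have ih := (ih (by omega)).1
        have e1 : i + (d + 1) - d = i + 1 := by omega
        have e2 : i + (d + 1) - (d + 1) = i := by omega
        rw [e1] at ih
        rw [e2]
        suffices h : (i : ℝ) * σ ^ (i + (d + 1)) < ((i + (d + 1) : ℕ) : ℝ) * σ ^ i from
          ⟨h.le, fun _ => h⟩
        refine lt_of_mul_lt_mul_left ?_ hσ0.le
        have hlt : σ * i < i + 1 := by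
          rw [hσ]
          have : (i : ℝ) / (i + (d + 1) : ℕ) < 1 := by
            rw [div_lt_one hjR]; push_cast; linarith
          calc _ = (i : ℝ) + i / (i + (d + 1) : ℕ) := by ring
            _ < _ := by linarith
        calc _ = (σ * i) * σ ^ (i + (d + 1)) := by ring
          _ < (i + 1) * σ ^ (i + (d + 1)) := by gcongr
          _ = ((i + 1 : ℕ) : ℝ) * σ ^ (i + (d + 1)) := by push_cast; ring
          _ ≤ ((i + (d + 1) : ℕ) : ℝ) * σ ^ (i + 1) := ih
          _ = _ := by ring
    have := key (j - i) (by omega)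
    rw [show j - (j - i) = i by omega] at this
    exact ⟨this.1, fun _ _ => this.2 (by omega)⟩

/-- For `(i + 1/2) / σ^i` the ratio of consecutive terms is `(1 + 1/(i + 1/2)) / σ`. It is never `1`
because `i + 1/2` is not an integer, so the maximum at `i = j` is unique. -/
theorem pow_mul_ge_half {j : ℕ} (hj : 0 < j) (i : ℕ) :
    (i + 1 / 2 : ℝ) * (1 + 1 / j) ^ j ≤ (j + 1 / 2) * (1 + 1 / j) ^ i ∧
      (i ≠ j → (i + 1 / 2 : ℝ) * (1 + 1 / j) ^ j < (j + 1 / 2) * (1 + 1 / j) ^ i) := by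
  have hjR : (0 : ℝ) < j := by exact_mod_cast hj
  set σ : ℝ := 1 + 1 / j with hσ
  have hσ0 : 0 < σ := by positivity
  have hpos : 0 < σ ^ j := by positivity
  rcases le_or_gt j i with h | h
  · induction i, h using Nat.le_induction with
    | base => exact ⟨le_rfl, fun h => absurd rfl h⟩
    | succ i hi ih =>
      have hiR : (j : ℝ) ≤ i := by exact_mod_cast hi
      have e : (j + 1 / 2 : ℝ) * σ ^ (i + 1) - ((i + 1 : ℕ) + 1 / 2) * σ ^ j =
          σ * ((j + 1 / 2) * σ ^ i - (i + 1 / 2) * σ ^ j) + ((i + 1 / 2 - j) / j) * σ ^ j := by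
        have : ((i + 1 / 2 - j) / j : ℝ) = σ * (i + 1 / 2) - (i + 3 / 2) := by
          rw [hσ]; field_simp; ring
        rw [this]; push_cast; ring
      have h1 := mul_nonneg hσ0.le (sub_nonneg.mpr ih.1)
      have h2 : 0 < ((i + 1 / 2 - j) / j : ℝ) * σ ^ j := by
        have : (0 : ℝ) < i + 1 / 2 - j := by linarith
        positivity
      exact ⟨by linarith, fun _ => by linarith⟩
  · have key : ∀ d : ℕ, d ≤ j → ((j - d : ℕ) + 1 / 2 : ℝ) * σ ^ j ≤ (j + 1 / 2) * σ ^ (j - d) ∧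
        (0 < d → ((j - d : ℕ) + 1 / 2 : ℝ) * σ ^ j < (j + 1 / 2) * σ ^ (j - d)) := by
      intro d
      induction d with
      | zero => intro _; simp
      | succ d ih =>
        intro hd
        obtain ⟨i, rfl⟩ : ∃ i, j = i + (d + 1) := ⟨j - (d + 1), by omega⟩
        have ih := (ih (by omega)).1
        have e1 : i + (d + 1) - d = i + 1 := by omega
        have e2 : i + (d + 1) - (d + 1) = i := by omega
        rw [e1] at ih
        rw [e2]
        suffices h : (i + 1 / 2 : ℝ) * σ ^ (i + (d + 1)) <
          ((i + (d + 1) : ℕ) + 1 / 2 : ℝ) * σ ^ i from ⟨h.le, fun _ => h⟩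
        refine lt_of_mul_lt_mul_left ?_ hσ0.le
        have hlt : σ * (i + 1 / 2) < (i + 1 : ℕ) + 1 / 2 := by
          rw [hσ]
          have : (i + 1 / 2 : ℝ) / (i + (d + 1) : ℕ) < 1 := by
            have : (0 : ℝ) ≤ d := Nat.cast_nonneg d
            rw [div_lt_one hjR]; push_cast; linarith
          calc _ = (i + 1 / 2 : ℝ) + (i + 1 / 2) / (i + (d + 1) : ℕ) := by ring
            _ < _ := by push_cast at this ⊢; linarith
        calc _ = (σ * (i + 1 / 2)) * σ ^ (i + (d + 1)) := by ring
          _ < ((i + 1 : ℕ) + 1 / 2) * σ ^ (i + (d + 1)) := by gcongr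
          _ ≤ ((i + (d + 1) : ℕ) + 1 / 2 : ℝ) * σ ^ (i + 1) := ih
          _ = _ := by ring
    have := key (j - i) (by omega)
    rw [show j - (j - i) = i by omega] at this
    exact ⟨this.1, fun _ => this.2 (by omega)⟩

/-- Here `w` counts the literals of probability `1/2`. Replacing two of them by one of probability
`p` and one of probability `1 - p` preserves `i + w/2` and lowers the product, since `(1 + 1/j) < (1
+ 1/(2j))^2`. This leaves `w = 0` and `w = 1`, where `j (1 + 1/(2j)) = j + 1/2`. -/
theorem pow_mul_pow_ge {j : ℕ} (hj : 0 < j) (w i : ℕ) :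
    (i + w / 2 : ℝ) * (1 + 1 / j) ^ j ≤ j * (1 + 1 / j) ^ i * (1 + 1 / (2 * j)) ^ w ∧
      (¬ (i = j ∧ w = 0) → ¬ (i = j + 1 ∧ w = 0) → ¬ (i = j ∧ w = 1) →
        (i + w / 2 : ℝ) * (1 + 1 / j) ^ j < j * (1 + 1 / j) ^ i * (1 + 1 / (2 * j)) ^ w) := by
  have hjR : (0 : ℝ) < j := by exact_mod_cast hj
  induction w using Nat.twoStepInduction generalizing i with
  | zero => simpa [and_comm] using pow_mul_ge hj i
  | one =>
    have e : (j : ℝ) * (1 + 1 / j) ^ i * (1 + 1 / (2 * j)) ^ 1 = (j + 1 / 2) * (1 + 1 / j) ^ i := by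
      field_simp
    have := pow_mul_ge_half hj i
    rw [e]
    simp only [Nat.cast_one]
    exact ⟨this.1, fun _ _ h => this.2 (by simpa using h)⟩
  | more w ih _ =>
    have hlt : (i + (w + 2 : ℕ) / 2 : ℝ) * (1 + 1 / j) ^ j <
        j * (1 + 1 / j) ^ i * (1 + 1 / (2 * j)) ^ (w + 2) := by
      have h1 := (ih (i + 1)).1
      have h2 : (1 + 1 / j : ℝ) < (1 + 1 / (2 * j)) ^ 2 := by
        have : (1 + 1 / (2 * j) : ℝ) ^ 2 = 1 + 1 / j + 1 / (4 * j ^ 2) := by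
          field_simp; ring
        rw [this]
        have : (0 : ℝ) < 1 / (4 * j ^ 2) := by positivity
        linarith
      calc _ = ((i + 1 : ℕ) + w / 2 : ℝ) * (1 + 1 / j) ^ j := by push_cast; ring
        _ ≤ _ := h1
        _ = (j * (1 + 1 / j) ^ i * (1 + 1 / (2 * j)) ^ w) * (1 + 1 / j) := by ring
        _ < (j * (1 + 1 / j) ^ i * (1 + 1 / (2 * j)) ^ w) * (1 + 1 / (2 * j)) ^ 2 := by gcongr
        _ = _ := by ring
    exact ⟨hlt.le, fun _ _ _ => hlt⟩

theorem pStar_eq (k : ℕ) (hk : 2 ≤ k) :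
    pStar k = ((k / 2 : ℕ) + 1) / (2 * (k / 2 : ℕ) + 1) := by
  rcases Nat.even_or_odd' k with ⟨c, rfl | rfl⟩
  · have : 2 * c / 2 = c := by omega
    rw [pStar, gammaK, if_neg (by simp), this]
    push_cast; field_simp; ring
  · have : (2 * c + 1) / 2 = c := by omega
    rw [pStar, gammaK, if_pos (by simp), this]
    push_cast; field_simp; ring

/-- The factor after `k` is the price `l` of the dual solution. For odd `k` the identity rests on `1
- p*_k = ⌊k/2⌋ / k`. -/
theorem alphaStar_eq_mul (k : ℕ) (hk : 2 ≤ k) :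
    alphaStar k = k * (pStar k ^ (k / 2) * (1 - pStar k) ^ (k - k / 2) / (k / 2 : ℕ)) := by
  rcases Nat.even_or_odd' k with ⟨c, rfl | rfl⟩
  · have e1 : 2 * c / 2 = c := by omega
    have e2 : 2 * c - c = c := by omega
    have hc : (0 : ℝ) < c := by
      have : 0 < c := by omega
      exact_mod_cast this
    rw [alphaStar, if_neg (by simp), e1, e2, mul_pow]
    push_cast; field_simp
  · have e1 : (2 * c + 1) / 2 = c := by omega
    have e2 : 2 * c + 1 - c = c + 1 := by omega
    have hc : (0 : ℝ) < c := by
      have : 0 < c := by omega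
      exact_mod_cast this
    have e3 : 1 - pStar (2 * c + 1) = c / (2 * c + 1) := by
      rw [pStar_eq _ hk, e1]; field_simp; ring
    rw [alphaStar, if_pos (by simp), e1, e2, mul_pow, pow_succ (1 - pStar (2 * c + 1)) c]
    nth_rewrite 3 [e3]
    push_cast; field_simp

/-- With `μ = l/2` and `1/N` replaced by `0`, both families of constraints with `α = k l` become `l
(i + w/2) ≤ p^i (1/2)^w q^s`. Its tight types `(i, w)` are `(j, 0)`, `(j + 1, 0)` and `(j, 1)`. The
terms of order `1/N` are positive at each of them, which leaves room for a larger `α`. -/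
theorem exists_dualFeasible_of_three_le (k : ℕ) (hk : 3 ≤ k) :
    ∃ (N : ℕ) (l μ α : ℝ), alphaStar k < α ∧ DualFeasible k (pStar k) N l μ α := by
  set j := k / 2 with hj
  have hj0 : 0 < j := by omega
  have hjR : (0 : ℝ) < j := by exact_mod_cast hj0
  set p := pStar k with hp
  have hpe : p = (j + 1) / (2 * j + 1) := pStar_eq k (by omega)
  have hqe : 1 - p = j / (2 * j + 1) := by rw [hpe]; field_simp; ring
  have hq0 : 0 < 1 - p := by rw [hqe]; positivity
  set q := 1 - p with hq
  have hpσ : p = q * (1 + 1 / j) := by rw [hpe, hqe]; field_simp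
  have hρ : (1 / 2 : ℝ) = q * (1 + 1 / (2 * j)) := by rw [hqe]; field_simp
  set l := p ^ j * q ^ (k - j) / j with hl
  have hle : l = q ^ k * ((1 + 1 / j) ^ j / j) := by
    have : q ^ k = q ^ j * q ^ (k - j) := by rw [← pow_add]; congr 1; omega
    rw [hl, this, hpσ, mul_pow]; ring
  have hl0 : 0 < l := by rw [hle]; positivity
  have hα : alphaStar k = k * l := alphaStar_eq_mul k (by omega)
  have hslack : ∀ i w s : ℕ, i + w + s = k →
      l * (i + w / 2) ≤ p ^ i * (1 / 2) ^ w * q ^ s ∧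
      (¬ (i = j ∧ w = 0) → ¬ (i = j + 1 ∧ w = 0) → ¬ (i = j ∧ w = 1) →
        l * (i + w / 2) < p ^ i * (1 / 2) ^ w * q ^ s) := by
    intro i w s h
    have e1 : p ^ i * (1 / 2) ^ w * q ^ s =
        (q ^ k / j) * (j * (1 + 1 / j) ^ i * (1 + 1 / (2 * j)) ^ w) := by
      rw [hρ, hpσ, mul_pow, mul_pow, ← h, pow_add, pow_add]
      field_simp
    have e2 : l * (i + w / 2) = (q ^ k / j) * ((i + w / 2 : ℝ) * (1 + 1 / j) ^ j) := by
      rw [hle]; ring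
    have hc : 0 < q ^ k / j := by positivity
    have := pow_mul_pow_ge hj0 w i
    rw [e1, e2]
    exact ⟨mul_le_mul_of_nonneg_left this.1 hc.le,
      fun a b c => mul_lt_mul_of_pos_left (this.2 a b c) hc⟩
  let I := (Finset.range (k + 1) ×ˢ Finset.range (k + 1)) ×ˢ Finset.range (k + 1)
  let slack : (ℕ × ℕ) × ℕ → ℝ := fun t =>
    p ^ t.1.1 * (1 / 2) ^ t.1.2 * q ^ t.2 - l * (t.1.1 + t.1.2 / 2)
  -- A perturbation `δ c` makes every constraint strict for all small `δ > 0`: at the tight types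
  -- since `c > 0`, at the others by continuity. The types lie in the finite set `I`, so one `δ`
  -- serves all.
  have hevent : ∀ c : (ℕ × ℕ) × ℕ → ℝ,
      (∀ i w s, i + w + s = k → (i = j ∧ w = 0) ∨ (i = j + 1 ∧ w = 0) ∨ (i = j ∧ w = 1) →
        0 < c ((i, w), s)) →
      ∀ᶠ δ : ℝ in nhdsWithin 0 (Set.Ioi 0), ∀ t ∈ I, t.1.1 + t.1.2 + t.2 = k →
        0 < slack t + δ * c t := by
    intro c hc
    rw [Filter.eventually_all_finset]
    rintro ⟨⟨i, w⟩, s⟩ -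
    by_cases h : i + w + s = k
    · have hs := hslack i w s h
      by_cases hcase : (i = j ∧ w = 0) ∨ (i = j + 1 ∧ w = 0) ∨ (i = j ∧ w = 1)
      · filter_upwards [self_mem_nhdsWithin] with δ hδ _
        have h1 := mul_pos (Set.mem_Ioi.mp hδ) (hc i w s h hcase)
        have h2 : 0 ≤ slack ((i, w), s) := sub_nonneg.mpr hs.1
        linarith
      · push Not at hcase
        have h2 : 0 < slack ((i, w), s) := sub_pos.mpr (hs.2 (by tauto) (by tauto) (by tauto))
        have ht : Filter.Tendsto (fun δ : ℝ => slack ((i, w), s) + δ * c ((i, w), s))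
            (nhdsWithin 0 (Set.Ioi 0)) (nhds (slack ((i, w), s) + 0 * c ((i, w), s))) :=
          ((continuous_const.add (continuous_id.mul continuous_const)).tendsto 0).mono_left
            nhdsWithin_le_nhds
        rw [zero_mul, add_zero] at ht
        filter_upwards [ht.eventually (lt_mem_nhds h2)] with δ hδ _
        exact hδ
    · exact Filter.Eventually.of_forall fun δ hk => absurd hk h
  have hunsat := hevent (fun t => l * (t.1.1 - t.1.2 / 2)) (by
    rintro i w s - (⟨rfl, rfl⟩ | ⟨rfl, rfl⟩ | ⟨rfl, rfl⟩)
    · simpa using mul_pos hl0 hjR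
    · simp only [Nat.cast_add, Nat.cast_one, CharP.cast_eq_zero]
      refine mul_pos hl0 (by linarith)
    · have : (1 : ℝ) ≤ j := by exact_mod_cast hj0
      refine mul_pos hl0 ?_
      push_cast; linarith)
  have hsat := hevent (fun t => l * (t.2 - t.1.2 / 2)) (by
    rintro i w s h hcase
    -- A tight type has `i + w ≤ j + 1`, and `k ≥ j + 2` because `k ≥ 3`. For `k = 2` the type `i =
    -- 2` would have `s = 0` and gain nothing.
    have hs : 1 ≤ s ∧ w ≤ 1 := by omega
    have h1 : (1 : ℝ) ≤ s := by exact_mod_cast hs.1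
    have h2 : (w : ℝ) ≤ 1 := by exact_mod_cast hs.2
    refine mul_pos hl0 ?_
    simp only
    linarith)
  have hN : Filter.Tendsto (fun N : ℕ => 1 / (N : ℝ)) Filter.atTop (nhdsWithin 0 (Set.Ioi 0)) := by
    refine tendsto_nhdsWithin_iff.mpr ⟨tendsto_one_div_atTop_nhds_zero_nat, ?_⟩
    filter_upwards [Filter.eventually_gt_atTop 0] with N hN
    have : (0 : ℝ) < N := by exact_mod_cast hN
    exact one_div_pos.mpr this
  obtain ⟨N, ⟨h1, h2⟩, h3⟩ :=
    (((hN.eventually hunsat).and (hN.eventually hsat)).and (Filter.eventually_gt_atTop 0)).exists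
  have hτ : ∀ᶠ τ : ℝ in nhdsWithin 0 (Set.Ioi 0), ∀ t ∈ I, t.1.1 + t.1.2 + t.2 = k →
      τ < slack t + 1 / N * (l * (t.2 - t.1.2 / 2)) := by
    rw [Filter.eventually_all_finset]
    intro t ht
    by_cases h : t.1.1 + t.1.2 + t.2 = k
    · filter_upwards [nhdsWithin_le_nhds (gt_mem_nhds (h2 t ht h))] with τ hτ _
      exact hτ
    · exact Filter.Eventually.of_forall fun δ hk => absurd hk h
  obtain ⟨τ, hτ, hτ0⟩ := (hτ.and self_mem_nhdsWithin).exists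
  have hτ0 : 0 < τ := hτ0
  have hmem : ∀ i w s : ℕ, i + w + s = k → ((i, w), s) ∈ I := by
    intro i w s h
    simp only [I, Finset.mem_product, Finset.mem_range]
    omega
  refine ⟨N, l, l / 2, k * l + τ, by linarith, ⟨?_, ?_, h3, hl0.le, by positivity, ?_, ?_⟩⟩
  · rw [hpe, le_div_iff₀ (by positivity)]; linarith
  · linarith
  · intro i w s h
    have := h1 _ (hmem i w s h) h
    simp only [slack] at this
    linear_combination this
  · intro i w s h
    have := hτ _ (hmem i w s h) h
    have hkR : (k : ℝ) = i + w + s := by rw [← h]; push_cast; ring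
    simp only [slack] at this
    rw [hkR]
    linear_combination this

/-- At `p*_2 = 2/3` the type `i = 2` blocks the perturbation, so `p` is moved up. The prices make
two `unsat` constraints tight: `l (1 - 1/20) = p (1 - p)` and `2 μ (1 + 1/20) = 1/4`. The ratio is
`9/20 > 4/9`. -/
theorem exists_dualFeasible_two :
    ∃ (N : ℕ) (l μ α : ℝ), alphaStar 2 < α ∧ DualFeasible 2 (41 / 60) N l μ α := by
  refine ⟨20, 779 / 3420, 5 / 42, 9 / 20, ?_, ⟨by norm_num, by norm_num, by norm_num, by norm_num,
    by norm_num, ?_, ?_⟩⟩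
  · have : ¬ Odd 2 := by decide
    norm_num [alphaStar, pStar, gammaK, this]
  · intro i w s h
    have hi : i ≤ 2 := by omega
    have hw : w ≤ 2 := by omega
    obtain rfl : s = 2 - i - w := by omega
    interval_cases i <;> interval_cases w <;> first | omega | norm_num
  · intro i w s h
    have hi : i ≤ 2 := by omega
    have hw : w ≤ 2 := by omega
    obtain rfl : s = 2 - i - w := by omega
    interval_cases i <;> interval_cases w <;> first | omega | norm_num

/-- For every `k ≥ 2` some oblivious rounding with rational parameters beats `α*_k`. -/
theorem exists_dualFeasible (k : ℕ) (hk : 2 ≤ k) :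
    ∃ (P h N : ℕ) (l μ α : ℝ), 0 < h ∧ P ≤ 2 * h ∧ alphaStar k < α ∧
      DualFeasible k ((P : ℝ) / (2 * h : ℕ)) N l μ α := by
  rcases Nat.lt_or_ge 2 k with h3 | h2
  · obtain ⟨N, l, μ, α, h1, h2⟩ := exists_dualFeasible_of_three_le k h3
    -- The even denominator `2h` allows `p`, `1 - p` and `1/2` all to have integer numerators.
    refine ⟨2 * (k / 2 + 1), 2 * (k / 2) + 1, N, l, μ, α, by omega, by omega, h1, ?_⟩
    convert h2 using 1
    rw [pStar_eq k hk]
    push_cast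
    field_simp
  · obtain rfl : k = 2 := by omega
    obtain ⟨N, l, μ, α, h1, h2⟩ := exists_dualFeasible_two
    exact ⟨41, 30, N, l, μ, α, by omega, by omega, h1, by norm_num at h2 ⊢; exact h2⟩

/-! ### Sampling without replacement -/

/-- Sampling without replacement is negatively correlated: by symmetry the sum is the same for every
`j ≠ i`, and since `g` has total zero these sums add up to `-∑ g(σ i)^2`. -/
theorem sum_perm_mul_nonpos {m : ℕ} (g : Fin m → ℝ) (hg : ∑ a, g a = 0) {i j : Fin m}
    (hij : i ≠ j) : ∑ σ : Equiv.Perm (Fin m), g (σ i) * g (σ j) ≤ 0 := by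
  classical
  have hsymm : ∀ j' ∈ Finset.univ.erase i,
      ∑ σ : Equiv.Perm (Fin m), g (σ i) * g (σ j') = ∑ σ : Equiv.Perm (Fin m), g (σ i) * g (σ j) := by
    intro j' hj'
    have hj' : j' ≠ i := (Finset.mem_erase.mp hj').1
    refine Fintype.sum_equiv (Equiv.mulRight (Equiv.swap j j')) _ _ fun σ => ?_
    simp [Equiv.swap_apply_of_ne_of_ne hij hj'.symm]
  have hzero : ∑ j' ∈ Finset.univ.erase i, ∑ σ : Equiv.Perm (Fin m), g (σ i) * g (σ j') =
      - ∑ σ : Equiv.Perm (Fin m), g (σ i) ^ 2 := by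
    rw [Finset.sum_comm, ← Finset.sum_neg_distrib]
    refine Finset.sum_congr rfl fun σ _ => ?_
    have : ∑ j', g (σ j') = 0 := by rw [Equiv.sum_comp σ g, hg]
    rw [← Finset.mul_sum, Finset.sum_erase_eq_sub (Finset.mem_univ i), this]
    ring
  rw [Finset.sum_congr rfl hsymm, Finset.sum_const, nsmul_eq_mul] at hzero
  have hcard : 0 < (Finset.univ.erase i).card :=
    Finset.card_pos.mpr ⟨j, Finset.mem_erase.mpr ⟨hij.symm, Finset.mem_univ j⟩⟩
  have hcard' : (0 : ℝ) < ((Finset.univ.erase i).card : ℝ) := by exact_mod_cast hcard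
  have hsq : 0 ≤ ∑ σ : Equiv.Perm (Fin m), g (σ i) ^ 2 :=
    Finset.sum_nonneg fun σ _ => sq_nonneg _
  by_contra! hpos
  have := mul_pos hcard' hpos
  linarith

/-- Off-diagonal terms are nonpositive, and each diagonal term is at most `1`. -/
theorem sum_perm_sq_le {m : ℕ} (g : Fin m → ℝ) (hg : ∑ a, g a = 0) (h1 : ∀ a, |g a| ≤ 1)
    (S : Finset (Fin m)) :
    ∑ σ : Equiv.Perm (Fin m), (∑ i ∈ S, g (σ i)) ^ 2 ≤
      S.card * (Fintype.card (Equiv.Perm (Fin m)) : ℝ) := by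
  classical
  have hexp : ∀ σ : Equiv.Perm (Fin m),
      (∑ i ∈ S, g (σ i)) ^ 2 = ∑ i ∈ S, ∑ j ∈ S, g (σ i) * g (σ j) := fun σ => by
    rw [sq, Finset.sum_mul_sum]
  simp_rw [hexp]
  rw [Finset.sum_comm, ← nsmul_eq_mul]
  refine Finset.sum_le_card_nsmul S _ _ fun i hi => ?_
  rw [Finset.sum_comm, ← Finset.add_sum_erase S _ hi]
  have hoff : ∑ j ∈ S.erase i, ∑ σ : Equiv.Perm (Fin m), g (σ i) * g (σ j) ≤ 0 :=
    Finset.sum_nonpos fun j hj => sum_perm_mul_nonpos g hg (Finset.mem_erase.mp hj).1.symm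
  have hdiag : ∑ σ : Equiv.Perm (Fin m), g (σ i) * g (σ i) ≤
      ∑ σ : Equiv.Perm (Fin m), (1 : ℝ) :=
    Finset.sum_le_sum fun σ _ => by
      rw [← abs_mul_abs_self]
      exact mul_le_one₀ (h1 _) (abs_nonneg _) (h1 _)
  have : ∑ σ : Equiv.Perm (Fin m), (1 : ℝ) = Fintype.card (Equiv.Perm (Fin m)) := by simp
  linarith

theorem permProb_compl_ge {m : ℕ} {E F : Set (Equiv.Perm (Fin m))} {η : ℝ}
    (hEF : ∀ σ, σ ∉ F → σ ∈ E) (hF : (F.ncard : ℝ) ≤ η * Fintype.card (Equiv.Perm (Fin m))) :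
    1 - η ≤ permProb m E := by
  classical
  have hN : (0 : ℝ) < Fintype.card (Equiv.Perm (Fin m)) := by exact_mod_cast Fintype.card_pos
  rw [permProb, le_div_iff₀ hN]
  have hsub : Fᶜ.ncard ≤ E.ncard := Set.ncard_le_ncard (fun σ hσ => hEF σ hσ) (Set.toFinite _)
  have hadd := Set.ncard_add_ncard_compl F
  rw [Nat.card_eq_fintype_card] at hadd
  have h1 : (F.ncard : ℝ) + Fᶜ.ncard = Fintype.card (Equiv.Perm (Fin m)) := by exact_mod_cast hadd
  have h2 : (Fᶜ.ncard : ℝ) ≤ E.ncard := by exact_mod_cast hsub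
  linarith

/-- The average of `f` over the first `min m T` elements of a random permutation is close to the
average of `f`. -/
theorem sampling {m T : ℕ} (hm : 0 < m) (hT : 0 < T) (f : Fin m → ℝ) (h0 : ∀ a, 0 ≤ f a)
    (h1 : ∀ a, f a ≤ 1) {δ : ℝ} (hδ : 0 < δ) {E : Set (Equiv.Perm (Fin m))}
    (hE : ∀ σ : Equiv.Perm (Fin m),
      |(∑ i with i.val < T, f (σ i)) / (min m T : ℕ) - (∑ a, f a) / m| ≤ δ → σ ∈ E) :
    1 - 1 / (T * δ ^ 2) ≤ permProb m E := by
  classical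
  have hmR : (0 : ℝ) < m := by exact_mod_cast hm
  have hTR : (0 : ℝ) < T := by exact_mod_cast hT
  refine permProb_compl_ge
    (F := {σ | δ < |(∑ i with i.val < T, f (σ i)) / (min m T : ℕ) - (∑ a, f a) / m|})
    (fun σ hσ => hE σ (not_lt.mp hσ)) ?_
  -- If `m ≤ T`, the sample is the whole stream and there is no error.
  rcases le_total m T with hmT | hTm
  · have : {σ : Equiv.Perm (Fin m) |
        δ < |(∑ i with i.val < T, f (σ i)) / (min m T : ℕ) - (∑ a, f a) / m|} = ∅ := by
      refine Set.eq_empty_of_forall_notMem fun σ hσ => ?_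
      have hfil : (Finset.univ.filter fun i : Fin m => i.val < T) = Finset.univ :=
        Finset.filter_true_of_mem fun i _ => i.isLt.trans_le hmT
      rw [Set.mem_ofPred_eq, hfil, Equiv.sum_comp σ f, min_eq_left hmT, sub_self, abs_zero] at hσ
      linarith
    rw [this, Set.ncard_empty]
    simp only [Nat.cast_zero]
    positivity
  · set μ := (∑ a, f a) / m with hμ
    have hμ0 : 0 ≤ μ := div_nonneg (Finset.sum_nonneg fun a _ => h0 a) hmR.le
    have hμ1 : μ ≤ 1 := by
      rw [hμ, div_le_one hmR]
      calc ∑ a, f a ≤ ∑ a : Fin m, (1 : ℝ) := Finset.sum_le_sum fun a _ => h1 a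
        _ = m := by simp
    have hS : (Finset.univ.filter fun i : Fin m => i.val < T).card = T := by
      rw [Fin.card_filter_val_lt, min_eq_right hTm]
    have hsq := sum_perm_sq_le (fun a => f a - μ)
      (by rw [Finset.sum_sub_distrib, Finset.sum_const, nsmul_eq_mul, Finset.card_univ,
            Fintype.card_fin, hμ]; field_simp; simp)
      (fun a => abs_le.mpr ⟨by linarith [h0 a], by linarith [h1 a]⟩)
      (Finset.univ.filter fun i : Fin m => i.val < T)
    rw [hS] at hsq
    set F := {σ : Equiv.Perm (Fin m) |
      δ < |(∑ i with i.val < T, f (σ i)) / (min m T : ℕ) - μ|} with hF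
    -- Chebyshev's inequality: each bad permutation contributes at least `(T δ)^2` to the second
    -- moment.
    have hlow : (F.ncard : ℝ) * (T * δ) ^ 2 ≤
        ∑ σ : Equiv.Perm (Fin m), (∑ i with i.val < T, (f (σ i) - μ)) ^ 2 := by
      rw [Set.ncard_eq_toFinset_card' F, ← nsmul_eq_mul]
      refine le_trans (Finset.card_nsmul_le_sum F.toFinset _ _ fun σ hσ => ?_)
        (Finset.sum_le_sum_of_subset_of_nonneg (Finset.subset_univ _)
          fun σ _ _ => sq_nonneg _)
      rw [Set.mem_toFinset, hF, Set.mem_ofPred_eq, min_eq_right hTm] at hσ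
      rw [Finset.sum_sub_distrib, Finset.sum_const, hS, nsmul_eq_mul, ← sq_abs (_ - _)]
      refine pow_le_pow_left₀ (by positivity) ?_ 2
      have : (∑ i with i.val < T, f (σ i)) - T * μ =
          T * ((∑ i with i.val < T, f (σ i)) / T - μ) := by field_simp
      rw [this, abs_mul, abs_of_pos hTR]
      exact mul_le_mul_of_nonneg_left hσ.le hTR.le
    have hfin : (F.ncard : ℝ) * (T * δ) ^ 2 ≤ T * Fintype.card (Equiv.Perm (Fin m)) :=
      hlow.trans hsq
    rw [div_mul_eq_mul_div, le_div_iff₀ (by positivity), one_mul]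
    refine le_of_mul_le_mul_left (a := (T : ℝ)) ?_ hTR
    calc _ = (F.ncard : ℝ) * (T * δ) ^ 2 := by ring
      _ ≤ _ := hfin

/-! ### Bounded runs of programs -/

/-- The memory cells from `A` on are `0`, and all cells and inputs are at most `B`. -/
def Bdd (A B : ℕ) (s : (ℕ →₀ ℕ) × List ℕ) : Prop :=
  (∀ i, A ≤ i → s.1 i = 0) ∧ (∀ i, s.1 i ≤ B) ∧ ∀ x ∈ s.2, x ≤ B

theorem Bdd.mono {A B B' : ℕ} {s : (ℕ →₀ ℕ) × List ℕ} (h : Bdd A B s) (hB : B ≤ B') :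
    Bdd A B' s :=
  ⟨h.1, fun i => (h.2.1 i).trans hB, fun x hx => (h.2.2 x hx).trans hB⟩

/-- The machine runs from one configuration to the other through bounded configurations. -/
def BddRun (A B : ℕ) : Config → Config → Prop :=
  Relation.ReflTransGen fun a b => Bdd A B (a.mem, a.input) ∧ step a = some b

theorem BddRun.step {A B : ℕ} {a b : Config} (h : Bdd A B (a.mem, a.input))
    (hs : MaxKAnd.step a = some b) : BddRun A B a b :=
  Relation.ReflTransGen.single ⟨h, hs⟩

theorem BddRun.trans {A B : ℕ} {a b c : Config} (h : BddRun A B a b) (h' : BddRun A B b c) :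
    BddRun A B a c :=
  Relation.ReflTransGen.trans h h'

theorem BddRun.reaches {A B : ℕ} {a b : Config} (h : BddRun A B a b) :
    StateTransition.Reaches MaxKAnd.step a b :=
  Relation.ReflTransGen.mono (fun _ _ h => h.2) _ _ h

/-- The machine is deterministic and `b` has halted, so every reachable configuration lies on the
given run. -/
theorem BddRun.bdd_of_reaches {A B : ℕ} {a b : Config} (h : BddRun A B a b)
    (hb : Bdd A B (b.mem, b.input)) (hh : MaxKAnd.step b = none) {c : Config}
    (hc : StateTransition.Reaches MaxKAnd.step a c) : Bdd A B (c.mem, c.input) := by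
  induction h using Relation.ReflTransGen.head_induction_on with
  | refl =>
    rcases Relation.ReflTransGen.cases_head hc with rfl | ⟨d, hd, -⟩
    · exact hb
    · rw [hh] at hd; simp at hd
  | head h1 _ ih =>
    rcases Relation.ReflTransGen.cases_head hc with rfl | ⟨d, hd, hdc⟩
    · exact h1.1
    · rw [h1.2, Option.mem_some_iff] at hd
      exact ih (hd ▸ hdc)

theorem Config.space_le {A B : ℕ} {c : Config} (h : Bdd A B (c.mem, c.input)) :
    c.space ≤ A * (Nat.size A + Nat.size B) := by
  have hsub : c.mem.support ⊆ Finset.range A := by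
    intro i hi
    rw [Finset.mem_range]
    by_contra hA
    exact Finsupp.mem_support_iff.mp hi (h.1 i (not_lt.mp hA))
  calc c.space = ∑ i ∈ c.mem.support, (Nat.size i + Nat.size (c.mem i)) := rfl
    _ ≤ ∑ i ∈ c.mem.support, (Nat.size A + Nat.size B) := by
        refine Finset.sum_le_sum fun i hi => ?_
        exact Nat.add_le_add (Nat.size_le_size (Finset.mem_range.mp (hsub hi)).le)
          (Nat.size_le_size (h.2.1 i))
    _ = c.mem.support.card * (Nat.size A + Nat.size B) := by simp
    _ ≤ _ := Nat.mul_le_mul_right _ (by simpa using Finset.card_le_card hsub)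

/-- The effect of a program without loops and indirect addressing. -/
noncomputable def Prog.eval : Prog → (ℕ →₀ ℕ) × List ℕ → (ℕ →₀ ℕ) × List ℕ
  | .skip, s => s
  | .seq p q, s => q.eval (p.eval s)
  | .const d c, s => (s.1.update d c, s.2)
  | .add d a b, s => (s.1.update d (s.1 a + s.1 b), s.2)
  | .sub d a b, s => (s.1.update d (s.1 a - s.1 b), s.2)
  | .mul d a b, s => (s.1.update d (s.1 a * s.1 b), s.2)
  | .read d, s => (s.1.update d (s.2.headD 0), s.2.tail)
  | .ite a p q, s => if s.1 a ≠ 0 then p.eval s else q.eval s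
  | _, s => s

/-- A program without divisions, loops and indirect addressing that uses only the memory cells
below `A` and constants up to `c`. -/
def Prog.Simple (A c : ℕ) : Prog → Prop
  | .skip => True
  | .seq p q => p.Simple A c ∧ q.Simple A c
  | .const d x => d < A ∧ x ≤ c
  | .add d a b => d < A ∧ a < A ∧ b < A
  | .sub d a b => d < A ∧ a < A ∧ b < A
  | .mul d a b => d < A ∧ a < A ∧ b < A
  | .read d => d < A
  | .ite a p q => a < A ∧ p.Simple A c ∧ q.Simple A c
  | _ => False

/-- The number of instructions of a program. -/
def Prog.length : Prog → ℕ
  | .seq p q => p.length + q.length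
  | .ite _ p q => p.length + q.length
  | .skip => 0
  | _ => 1

theorem Prog.Simple.mono {A c c' : ℕ} (hc : c ≤ c') {p : Prog} (h : p.Simple A c) :
    p.Simple A c' := by
  induction p with
  | seq p q ihp ihq => exact ⟨ihp h.1, ihq h.2⟩
  | ite a p q ihp ihq => exact ⟨h.1, ihp h.2.1, ihq h.2.2⟩
  | const d x => exact ⟨h.1, h.2.trans hc⟩
  | _ => exact h

theorem Bdd.update {A B d v : ℕ} {R : ℕ →₀ ℕ} {w : List ℕ} (h : Bdd A B (R, w)) (hd : d < A)
    (hv : v ≤ B) : Bdd A B (R.update d v, w) := by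
  refine ⟨fun i hi => ?_, fun i => ?_, h.2.2⟩
  · rw [Finsupp.coe_update, Function.update_of_ne (by omega)]
    exact h.1 i hi
  · rw [Finsupp.coe_update, Function.update_apply]
    split_ifs
    · exact hv
    · exact h.2.1 i

theorem le_pow_two_pow (B e : ℕ) : B ≤ B ^ 2 ^ e :=
  Nat.le_self_pow (by positivity) B

theorem pow_two_pow_mono {B e e' : ℕ} (hB : 2 ≤ B) (h : e ≤ e') : B ^ 2 ^ e ≤ B ^ 2 ^ e' :=
  Nat.pow_le_pow_right (by omega) (Nat.pow_le_pow_right (by omega) h)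

/-- A simple program runs as `Prog.eval` says, and at worst squares the bound on the contents of
the memory in each step. -/
theorem Prog.Simple.run {A : ℕ} (p : Prog) : ∀ {B B' : ℕ} {s : (ℕ →₀ ℕ) × List ℕ} (K : List Prog),
    p.Simple A B → 2 ≤ B → Bdd A B s → B ^ 2 ^ p.length ≤ B' →
    BddRun A B' ⟨p :: K, s.1, s.2⟩ ⟨K, (p.eval s).1, (p.eval s).2⟩ ∧
      Bdd A (B ^ 2 ^ p.length) (p.eval s) := by
  induction p with
  | skip =>
    intro B B' s K _ _ h hB'
    have h3 := le_pow_two_pow B Prog.skip.length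
    exact ⟨.step (h.mono (h3.trans hB')) rfl, h.mono h3⟩
  | seq p q ihp ihq =>
    intro B B' s K hs hB h hB'
    have h1 : B ≤ B' := (le_pow_two_pow _ _).trans hB'
    have h2 : B ^ 2 ^ p.length ≤ B' :=
      (pow_two_pow_mono hB (Nat.le_add_right _ _)).trans hB'
    have h3 : B ≤ B ^ 2 ^ p.length := le_pow_two_pow _ _
    have h4 : (B ^ 2 ^ p.length) ^ 2 ^ q.length = B ^ 2 ^ (Prog.seq p q).length := by
      rw [← pow_mul, ← pow_add]; rfl
    obtain ⟨r1, b1⟩ := ihp (q :: K) hs.1 hB h h2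
    obtain ⟨r2, b2⟩ := ihq K (hs.2.mono h3) (hB.trans h3) b1 (h4.le.trans hB')
    exact ⟨(BddRun.step (h.mono h1) rfl).trans (r1.trans r2), h4 ▸ b2⟩
  | ite a p q ihp ihq =>
    intro B B' s K hs hB h hB'
    have h1 : B ≤ B' := (le_pow_two_pow _ _).trans hB'
    have h2 : B ^ 2 ^ p.length ≤ B ^ 2 ^ (Prog.ite a p q).length :=
      pow_two_pow_mono hB (Nat.le_add_right _ _)
    have h3 : B ^ 2 ^ q.length ≤ B ^ 2 ^ (Prog.ite a p q).length :=
      pow_two_pow_mono hB (Nat.le_add_left _ _)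
    obtain ⟨r1, b1⟩ := ihp K hs.2.1 hB h (h2.trans hB')
    obtain ⟨r2, b2⟩ := ihq K hs.2.2 hB h (h3.trans hB')
    have hstep : BddRun A B' ⟨Prog.ite a p q :: K, s.1, s.2⟩
        ⟨(if s.1 a ≠ 0 then p else q) :: K, s.1, s.2⟩ := .step (h.mono h1) rfl
    by_cases ha : s.1 a ≠ 0
    · rw [if_pos ha] at hstep
      rw [Prog.eval, if_pos ha]
      exact ⟨hstep.trans r1, b1.mono h2⟩
    · rw [if_neg ha] at hstep
      rw [Prog.eval, if_neg ha]
      exact ⟨hstep.trans r2, b2.mono h3⟩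
  | const d c =>
    intro B B' s K hs hB h hB'
    have h0 : B ≤ B ^ 2 ^ 1 := le_pow_two_pow _ _
    exact ⟨.step (h.mono (h0.trans hB')) rfl, (h.mono h0).update hs.1 (hs.2.trans h0)⟩
  | add d a b =>
    intro B B' s K hs hB h hB'
    have h0 : B ≤ B ^ 2 ^ 1 := le_pow_two_pow _ _
    refine ⟨.step (h.mono (h0.trans hB')) rfl, (h.mono h0).update hs.1 ?_⟩
    have := h.2.1 a
    have := h.2.1 b
    change _ ≤ B ^ 2 ^ 1
    rw [show B ^ 2 ^ 1 = B * B by ring]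
    nlinarith
  | sub d a b =>
    intro B B' s K hs hB h hB'
    have h0 : B ≤ B ^ 2 ^ 1 := le_pow_two_pow _ _
    exact ⟨.step (h.mono (h0.trans hB')) rfl,
      (h.mono h0).update hs.1 (((Nat.sub_le _ _).trans (h.2.1 a)).trans h0)⟩
  | mul d a b =>
    intro B B' s K hs hB h hB'
    have h0 : B ≤ B ^ 2 ^ 1 := le_pow_two_pow _ _
    refine ⟨.step (h.mono (h0.trans hB')) rfl, (h.mono h0).update hs.1 ?_⟩
    rw [show B ^ 2 ^ 1 = B * B by ring]
    exact Nat.mul_le_mul (h.2.1 a) (h.2.1 b)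
  | read d =>
    intro B B' s K hs hB h hB'
    have h0 : B ≤ B ^ 2 ^ 1 := le_pow_two_pow _ _
    have hhead : s.2.headD 0 ≤ B := by
      have := h.2.2
      cases hw : s.2 with
      | nil => simp
      | cons x w => exact this x (by simp [hw])
    refine ⟨.step (h.mono (h0.trans hB')) rfl, Bdd.mono ?_ h0⟩
    have ht : Bdd A B (s.1, s.2.tail) :=
      ⟨h.1, h.2.1, fun x hx => h.2.2 x (List.mem_of_mem_tail hx)⟩
    exact ht.update hs hhead
  | _ => exact fun K hs => hs.elim

/-! ### From polynomial bounds to logarithmic space -/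

theorem size_pow_le (n e : ℕ) : Nat.size (n ^ e) ≤ Nat.size n * e + 1 := by
  rw [Nat.size_le, pow_succ, pow_mul]
  have : n ^ e ≤ (2 ^ Nat.size n) ^ e := Nat.pow_le_pow_left (Nat.lt_size_self n).le e
  have : 0 < (2 ^ Nat.size n) ^ e := by positivity
  omega

theorem size_le_log {n : ℕ} (hn : 2 ≤ n) : (Nat.size n : ℝ) ≤ 2 / Real.log 2 * Real.log n := by
  have h2 : 0 < Real.log 2 := Real.log_pos (by norm_num)
  have hlog : Real.log 2 ≤ Real.log n :=
    Real.log_le_log (by norm_num) (by exact_mod_cast hn)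
  have h1 : 0 < Nat.size n := Nat.size_pos.mpr (by omega)
  obtain ⟨t, ht⟩ : ∃ t, Nat.size n = t + 1 := ⟨Nat.size n - 1, by omega⟩
  have hle : 2 ^ t ≤ n := Nat.lt_size.mp (by omega)
  have hle' : (t : ℝ) * Real.log 2 ≤ Real.log n := by
    rw [← Real.log_pow]
    exact Real.log_le_log (by positivity) (by exact_mod_cast hle)
  rw [ht, div_mul_eq_mul_div, le_div_iff₀ h2]
  push_cast
  linarith

/-- The cost of polynomially bounded memory cells. -/
theorem exists_space_bound (A e : ℕ) : ∃ C : ℝ, ∀ n : ℕ, 2 ≤ n →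
    ((A * (Nat.size A + Nat.size (n ^ e)) : ℕ) : ℝ) ≤ C * Real.log n := by
  refine ⟨A * ((Nat.size A + 1) / Real.log 2 + e * (2 / Real.log 2)), fun n hn => ?_⟩
  have h2 : 0 < Real.log 2 := Real.log_pos (by norm_num)
  have hlog : Real.log 2 ≤ Real.log n :=
    Real.log_le_log (by norm_num) (by exact_mod_cast hn)
  have h1 : (Nat.size (n ^ e) : ℝ) ≤ Nat.size n * e + 1 := by exact_mod_cast size_pow_le n e
  have h3 := mul_le_mul_of_nonneg_right (size_le_log hn) (Nat.cast_nonneg (α := ℝ) e)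
  have h4 : (Nat.size A + 1 : ℝ) ≤ (Nat.size A + 1) / Real.log 2 * Real.log n := by
    rw [div_mul_eq_mul_div, le_div_iff₀ h2]
    exact mul_le_mul_of_nonneg_left hlog (by positivity)
  push_cast
  rw [mul_assoc]
  refine mul_le_mul_of_nonneg_left ?_ (Nat.cast_nonneg A)
  rw [add_mul]
  linarith

theorem haltsWithOutput_of_bddRun {A B n : ℕ} {P : Prog} {w : List ℕ} {s : (ℕ →₀ ℕ) × List ℕ}
    (h : BddRun A B (start P n w) ⟨[], s.1, s.2⟩) :
    HaltsWithOutput P n w ((s.1 0 : ℝ) / s.1 1) :=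
  ⟨⟨[], s.1, s.2⟩, StateTransition.mem_eval.mpr ⟨h.reaches, rfl⟩, rfl⟩

theorem runsInSpace_of_bddRun {A B n : ℕ} {P : Prog} {w : List ℕ} {s : (ℕ →₀ ℕ) × List ℕ}
    (h : BddRun A B (start P n w) ⟨[], s.1, s.2⟩) (hs : Bdd A B s) {S : ℝ}
    (hS : ((A * (Nat.size A + Nat.size B) : ℕ) : ℝ) ≤ S) : RunsInSpace P n w S := by
  intro c hc
  refine le_trans ?_ hS
  exact_mod_cast Config.space_le (h.bdd_of_reaches hs rfl hc)

/-! ### The streaming algorithm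

Four memory cells belong to each of the first `M` literals of the stream: its variable, its sign, the
number of its occurrences in the stream and the number of occurrences of its negation. -/

/-- The cell for the variable of the literal `t`. -/
def varCell (t : ℕ) : ℕ := 10 + 4 * t
/-- The cell for the sign of the literal `t`. -/
def signCell (t : ℕ) : ℕ := 11 + 4 * t
/-- The cell for the number of occurrences of the literal `t`. -/
def sameCell (t : ℕ) : ℕ := 12 + 4 * t
/-- The cell for the number of occurrences of the negation of the literal `t`. -/
def oppCell (t : ℕ) : ℕ := 13 + 4 * t

/-- Compare the literal in `R[2], R[3]` with the literal `t`. -/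
def countOne (t : ℕ) : Prog :=
  -- Truncated subtraction vanishes in both directions exactly for equal numbers; for the signs, the
  -- two differences are added.
  .seq (.sub 4 2 (varCell t)) (.ite 4 .skip
    (.seq (.sub 4 (varCell t) 2) (.ite 4 .skip
      (.seq (.sub 4 3 (signCell t)) (.seq (.sub 5 (signCell t) 3) (.seq (.add 4 4 5)
        (.ite 4 (.seq (.const 4 1) (.add (oppCell t) (oppCell t) 4))
          (.seq (.const 4 1) (.add (sameCell t) (sameCell t) 4)))))))))

/-- Compare the literal in `R[2], R[3]` with the first `M` literals. -/
def countUpTo : ℕ → Prog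
  | 0 => .skip
  | M + 1 => .seq (countUpTo M) (countOne M)

/-- Compare the literal in `R[2], R[3]` with the first `M` literals and clear the scratch cells. -/
def countAll (M : ℕ) : Prog := .seq (countUpTo M) (.seq (.const 4 0) (.const 5 0))

/-- Read the first `t` literals. -/
def readLits : ℕ → Prog
  | 0 => .skip
  | t + 1 => .seq (readLits t) (.seq (.read (varCell t)) (.read (signCell t)))

/-- Compare the first `t` literals with the first `M` literals. -/
def selfCount (M : ℕ) : ℕ → Prog
  | 0 => .skip
  | t + 1 => .seq (selfCount M t)
      -- `R[4]` is `0` here, so the additions are copies.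
      (.seq (.add 2 (varCell t) 4) (.seq (.add 3 (signCell t) 4) (countAll M)))

/-- Put `c` times the probability of the literal `t` into `R[5]`, where `c = 2 * h`. -/
def litWeight (P h N t : ℕ) : Prog :=
  -- In the end `R[8]` is zero iff the bias is at least `1/N`, and `R[9]` is zero iff it is at most
  -- `-1/N`.
  .seq (.add 4 (sameCell t) (oppCell t)) (.seq (.const 5 N) (.seq (.mul 6 5 (sameCell t))
    (.seq (.mul 7 5 (oppCell t)) (.seq (.add 8 4 7) (.seq (.sub 8 8 6) (.seq (.add 9 4 6)
      (.seq (.sub 9 9 7) (.ite 8 (.ite 9 (.const 5 h) (.const 5 (2 * h - P))) (.const 5 P)))))))))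

/-- Put the product of the weights of the literals `t₀, …, t₀ + l - 1` into `R[3]`. -/
def prodWeight (P h N t₀ : ℕ) : ℕ → Prog
  | 0 => .const 3 1
  | l + 1 => .seq (prodWeight P h N t₀ l) (.seq (litWeight P h N (t₀ + l)) (.mul 3 3 5))

/-- Put the sum of the weights of the first `T` clauses into `R[0]` and add their number
to `R[1]`. -/
def sumWeight (P h N k : ℕ) : ℕ → Prog
  | 0 => .const 0 0
  -- Variables are numbered from `1`, so a `0` marks a clause beyond the end of the stream.
  | T + 1 => .seq (sumWeight P h N k T) (.ite (varCell (T * k))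
      (.seq (prodWeight P h N (T * k) k) (.seq (.add 0 0 3) (.seq (.const 5 1) (.add 1 1 5)))) .skip)

/-- Put the output `(R[0] / (D R[1]) - 1 / E)⁺` into the first two cells. -/
def writeOutput (D E : ℕ) : Prog :=
  .seq (.const 3 E) (.seq (.mul 0 0 3) (.seq (.const 4 D) (.seq (.mul 1 1 4)
    (.seq (.sub 0 0 1) (.mul 1 1 3)))))

/-- What is done before the loop. -/
def prologue (M : ℕ) : Prog := .seq (readLits M) (.seq (selfCount M M) (.read 2))

/-- The body of the loop. -/
def loopBody (M : ℕ) : Prog := .seq (.read 3) (.seq (countAll M) (.read 2))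

/-- What is done after the loop. -/
def epilogue (P h N k T E : ℕ) : Prog :=
  .seq (sumWeight P h N k T) (writeOutput ((2 * h) ^ k) E)

/-- The streaming algorithm: estimate the value of the oblivious rounding from the first `T`
clauses. -/
def algorithm (P h N k T E : ℕ) : Prog :=
  -- The variable of the next literal is always read ahead into `R[2]`; at the end of the stream it
  -- is `0` and stops the loop.
  .seq (prologue (T * k)) (.seq (.loop 2 (loopBody (T * k))) (epilogue P h N k T E))

/-! ### The effect of the subprograms on the memory -/

theorem countOne_eval (t : ℕ) (s : (ℕ →₀ ℕ) × List ℕ) :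
    ((countOne t).eval s).2 = s.2 ∧
    ((countOne t).eval s).1 (sameCell t) = s.1 (sameCell t) +
      (if s.1 2 = s.1 (varCell t) ∧ s.1 3 = s.1 (signCell t) then 1 else 0) ∧
    ((countOne t).eval s).1 (oppCell t) = s.1 (oppCell t) +
      (if s.1 2 = s.1 (varCell t) ∧ s.1 3 ≠ s.1 (signCell t) then 1 else 0) ∧
    ∀ x, x ≠ 4 → x ≠ 5 → x ≠ sameCell t → x ≠ oppCell t →
      ((countOne t).eval s).1 x = s.1 x := by
  have h1 : varCell t ≠ 4 := by unfold varCell; omega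
  have h2 : signCell t ≠ 4 := by unfold signCell; omega
  have h3 : sameCell t ≠ 4 := by unfold sameCell; omega
  have h4 : oppCell t ≠ 4 := by unfold oppCell; omega
  have h3' : sameCell t ≠ 5 := by unfold sameCell; omega
  have h4' : oppCell t ≠ 5 := by unfold oppCell; omega
  have h5 : sameCell t ≠ oppCell t := by unfold sameCell oppCell; omega
  simp only [countOne, Prog.eval, Finsupp.coe_update, Function.update_apply]
  simp only [h1, h2, h3, h4, if_true, if_false, ne_eq,
    show (2 : ℕ) ≠ 4 by decide, show (3 : ℕ) ≠ 4 by decide, show (4 : ℕ) ≠ 5 by decide,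
    show (5 : ℕ) ≠ 4 by decide]
  split_ifs <;> simp only [Finsupp.coe_update, Function.update_apply, h3, h4, h3', h4', h5, h5.symm,
    if_true, if_false] <;>
    (repeat' refine And.intro ?_ ?_) <;>
    first | trivial | omega | (intro x a b c d; simp only [a, b, c, d, if_false])

theorem countUpTo_eval (M : ℕ) (s : (ℕ →₀ ℕ) × List ℕ) :
    ((countUpTo M).eval s).2 = s.2 ∧
    (∀ t < M, ((countUpTo M).eval s).1 (sameCell t) = s.1 (sameCell t) +
        (if s.1 2 = s.1 (varCell t) ∧ s.1 3 = s.1 (signCell t) then 1 else 0) ∧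
      ((countUpTo M).eval s).1 (oppCell t) = s.1 (oppCell t) +
        (if s.1 2 = s.1 (varCell t) ∧ s.1 3 ≠ s.1 (signCell t) then 1 else 0)) ∧
    ∀ x, x ≠ 4 → x ≠ 5 → (∀ t < M, x ≠ sameCell t ∧ x ≠ oppCell t) →
      ((countUpTo M).eval s).1 x = s.1 x := by
  induction M with
  | zero => exact ⟨rfl, fun t ht => absurd ht (Nat.not_lt_zero t), fun _ _ _ _ => rfl⟩
  | succ M ih =>
    obtain ⟨h1, h2, h3⟩ := ih
    obtain ⟨g1, g2, g3, g4⟩ := countOne_eval M ((countUpTo M).eval s)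
    have hc : ∀ x, x ≠ 4 → x ≠ 5 → (∀ t, x = sameCell t ∨ x = oppCell t → t = M) →
        ((countUpTo M).eval s).1 x = s.1 x := fun x a b c =>
      h3 x a b fun t ht => ⟨fun h => by have := c t (.inl h); omega,
        fun h => by have := c t (.inr h); omega⟩
    rw [hc 2 (by omega) (by omega) (by unfold sameCell oppCell; omega),
      hc 3 (by omega) (by omega) (by unfold sameCell oppCell; omega),
      hc (varCell M) (by unfold varCell; omega) (by unfold varCell; omega)
        (by unfold varCell sameCell oppCell; omega),
      hc (signCell M) (by unfold signCell; omega) (by unfold signCell; omega)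
        (by unfold signCell sameCell oppCell; omega)] at g2 g3
    rw [hc (sameCell M) (by unfold sameCell; omega) (by unfold sameCell; omega)
        (by unfold sameCell oppCell; omega)] at g2
    rw [hc (oppCell M) (by unfold oppCell; omega) (by unfold oppCell; omega)
        (by unfold sameCell oppCell; omega)] at g3
    refine ⟨g1.trans h1, fun t ht => ?_, fun x a b c => ?_⟩
    · rcases Nat.lt_succ_iff_lt_or_eq.mp ht with ht | rfl
      · have h4 := h2 t ht
        rw [← g4 (sameCell t) (by unfold sameCell; omega) (by unfold sameCell; omega)
            (by unfold sameCell; omega) (by unfold sameCell oppCell; omega),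
          ← g4 (oppCell t) (by unfold oppCell; omega) (by unfold oppCell; omega)
            (by unfold sameCell oppCell; omega) (by unfold oppCell; omega)] at h4
        exact h4
      · exact ⟨g2, g3⟩
    · exact (g4 x a b (c M (by omega)).1 (c M (by omega)).2).trans
        (h3 x a b fun t ht => c t (by omega))

/-- The memory after the literals in `X` have been counted: `V` and `S` are the variables and the
signs of the first `M` literals. -/
structure Counted (M n b : ℕ) (V S : ℕ → ℕ) (X : List (ℕ × ℕ)) (R : ℕ →₀ ℕ) : Prop where
  zero : R 0 = n
  two : R 2 ≤ b
  three : R 3 ≤ b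
  other : ∀ x, x ≠ 0 → x ≠ 2 → x ≠ 3 → (x < 10 ∨ 10 + 4 * M ≤ x) → R x = 0
  var : ∀ t < M, R (varCell t) = V t
  sign : ∀ t < M, R (signCell t) = S t
  same : ∀ t < M, R (sameCell t) = X.countP fun x => x.1 = V t ∧ x.2 = S t
  opp : ∀ t < M, R (oppCell t) = X.countP fun x => x.1 = V t ∧ x.2 ≠ S t

theorem Counted.update {M n b : ℕ} {V S : ℕ → ℕ} {X : List (ℕ × ℕ)} {R : ℕ →₀ ℕ}
    (h : Counted M n b V S X R) {d v : ℕ} (hd : d = 2 ∨ d = 3) (hv : v ≤ b) :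
    Counted M n b V S X (R.update d v) := by
  have hu : ∀ x, x ≠ 2 → x ≠ 3 → (R.update d v) x = R x := fun x h2 h3 => by
    rw [Finsupp.coe_update, Function.update_of_ne (by omega)]
  have hb : ∀ x, R x ≤ b → (R.update d v) x ≤ b := fun x hx => by
    rw [Finsupp.coe_update, Function.update_apply]
    split_ifs <;> assumption
  refine ⟨?_, hb 2 h.two, hb 3 h.three, fun x h0 h2 h3 hx => ?_, fun t ht => ?_, fun t ht => ?_,
    fun t ht => ?_, fun t ht => ?_⟩
  · rw [hu 0 (by omega) (by omega), h.zero]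
  · rw [hu x h2 h3, h.other x h0 h2 h3 hx]
  · rw [hu _ (by unfold varCell; omega) (by unfold varCell; omega), h.var t ht]
  · rw [hu _ (by unfold signCell; omega) (by unfold signCell; omega), h.sign t ht]
  · rw [hu _ (by unfold sameCell; omega) (by unfold sameCell; omega), h.same t ht]
  · rw [hu _ (by unfold oppCell; omega) (by unfold oppCell; omega), h.opp t ht]

/-- Clearing cells `4` and `5` restores the field `other`, so that `Counted` is an invariant of the
loop. -/
theorem countAll_eval {M n b : ℕ} {V S : ℕ → ℕ} {X : List (ℕ × ℕ)} {s : (ℕ →₀ ℕ) × List ℕ}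
    (h : Counted M n b V S X s.1) :
    ((countAll M).eval s).2 = s.2 ∧
      Counted M n b V S (X ++ [(s.1 2, s.1 3)]) ((countAll M).eval s).1 := by
  obtain ⟨h1, h2, h3⟩ := countUpTo_eval M s
  have he : ∀ x, ((countAll M).eval s).1 x =
      if x = 4 ∨ x = 5 then 0 else ((countUpTo M).eval s).1 x := fun x => by
    simp only [countAll, Prog.eval, Finsupp.coe_update, Function.update_apply]
    split_ifs <;> first | rfl | omega
  have hs : ∀ x, (∀ t < M, x ≠ sameCell t ∧ x ≠ oppCell t) → x ≠ 4 → x ≠ 5 →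
      ((countAll M).eval s).1 x = s.1 x := fun x h h4 h5 => by
    rw [he, if_neg (by omega), h3 x h4 h5 h]
  refine ⟨h1, ⟨?_, ?_, ?_, fun x h0 h2 h3 hx => ?_, fun t ht => ?_, fun t ht => ?_,
    fun t ht => ?_, fun t ht => ?_⟩⟩
  · rw [hs 0 (by unfold sameCell oppCell; omega) (by omega) (by omega), h.zero]
  · rw [hs 2 (by unfold sameCell oppCell; omega) (by omega) (by omega)]; exact h.two
  · rw [hs 3 (by unfold sameCell oppCell; omega) (by omega) (by omega)]; exact h.three
  · by_cases h45 : x = 4 ∨ x = 5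
    · rw [he, if_pos h45]
    · rw [hs x (by unfold sameCell oppCell; omega) (by omega) (by omega), h.other x h0 h2 h3 hx]
  · rw [hs _ (by unfold varCell sameCell oppCell; omega) (by unfold varCell; omega)
      (by unfold varCell; omega), h.var t ht]
  · rw [hs _ (by unfold signCell sameCell oppCell; omega) (by unfold signCell; omega)
      (by unfold signCell; omega), h.sign t ht]
  · rw [he, if_neg (by unfold sameCell; omega), (h2 t ht).1, h.same t ht, h.var t ht, h.sign t ht,
      List.countP_append, List.countP_singleton]
    simp
  · rw [he, if_neg (by unfold oppCell; omega), (h2 t ht).2, h.opp t ht, h.var t ht, h.sign t ht,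
      List.countP_append, List.countP_singleton]
    simp

/-- The stream of a list of literals. -/
def flat (L : List (ℕ × ℕ)) : List ℕ := L.flatMap fun x => [x.1, x.2]

/-- The default `(0, 0)` matches the zeros that the machine reads beyond the end of a short stream.
-/
theorem readLits_eval (L : List (ℕ × ℕ)) (t : ℕ) (s : (ℕ →₀ ℕ) × List ℕ) (hs : s.2 = flat L) :
    ((readLits t).eval s).2 = flat (L.drop t) ∧
    (∀ i < t, ((readLits t).eval s).1 (varCell i) = (L.getD i (0, 0)).1 ∧
      ((readLits t).eval s).1 (signCell i) = (L.getD i (0, 0)).2) ∧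
    ∀ x, (∀ i < t, x ≠ varCell i ∧ x ≠ signCell i) → ((readLits t).eval s).1 x = s.1 x := by
  induction t with
  | zero => exact ⟨by simpa [readLits, Prog.eval] using hs,
      fun i hi => absurd hi (Nat.not_lt_zero i), fun _ _ => rfl⟩
  | succ t ih =>
    obtain ⟨h1, h2, h3⟩ := ih
    have hne : varCell t ≠ signCell t := by unfold varCell signCell; omega
    have hw : (((readLits t).eval s).2.headD 0 = (L.getD t (0, 0)).1 ∧
        ((readLits t).eval s).2.tail.headD 0 = (L.getD t (0, 0)).2) ∧
        ((readLits t).eval s).2.tail.tail = flat (L.drop (t + 1)) := by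
      rw [h1]
      rcases lt_or_ge t L.length with h | h
      · rw [List.drop_eq_getElem_cons h, List.getD_eq_getElem _ _ h]
        exact ⟨⟨rfl, rfl⟩, rfl⟩
      · rw [List.drop_eq_nil_of_le h, List.drop_eq_nil_of_le (by omega),
          List.getD_eq_default _ _ h]
        simp [flat]
    have he : ∀ x, ((readLits (t + 1)).eval s).1 x =
        if x = signCell t then (L.getD t (0, 0)).2 else
        if x = varCell t then (L.getD t (0, 0)).1 else ((readLits t).eval s).1 x := fun x => by
      rw [← hw.1.1, ← hw.1.2]
      simp only [readLits, Prog.eval, Finsupp.coe_update, Function.update_apply]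
    refine ⟨hw.2, fun i hi => ?_, fun x hx => ?_⟩
    · rcases Nat.lt_succ_iff_lt_or_eq.mp hi with hi | rfl
      · rw [he, he, if_neg (by unfold varCell signCell; omega), if_neg (by unfold varCell; omega),
          if_neg (by unfold signCell; omega), if_neg (by unfold varCell signCell; omega)]
        exact h2 i hi
      · rw [he, he, if_neg hne, if_pos rfl, if_pos rfl]
        exact ⟨rfl, rfl⟩
    · rw [he, if_neg (hx t (by omega)).2, if_neg (hx t (by omega)).1]
      exact h3 x fun i hi => hx i (by omega)

/-- The first `M` literals are stored without being counted as they are read, so they are counted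
afterwards from memory. -/
theorem selfCount_eval {M n b : ℕ} {V S : ℕ → ℕ} (hV : ∀ t < M, V t ≤ b) (hS : ∀ t < M, S t ≤ b)
    {s : (ℕ →₀ ℕ) × List ℕ} (h : Counted M n b V S [] s.1) (t : ℕ) (ht : t ≤ M) :
    ((selfCount M t).eval s).2 = s.2 ∧
      Counted M n b V S ((List.range t).map fun i => (V i, S i)) ((selfCount M t).eval s).1 := by
  induction t with
  | zero => exact ⟨rfl, h⟩
  | succ t ih =>
    obtain ⟨h1, h2⟩ := ih (by omega)
    set s' := (selfCount M t).eval s with hs'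
    have e4 : s'.1 4 = 0 := h2.other 4 (by omega) (by omega) (by omega) (by omega)
    have c1 := h2.update (d := 2) (v := V t) (.inl rfl) (hV t ht)
    have c2 := c1.update (d := 3) (v := S t) (.inr rfl) (hS t ht)
    have hev : (selfCount M (t + 1)).eval s =
        (countAll M).eval ((s'.1.update 2 (V t)).update 3 (S t), s'.2) := by
      simp only [selfCount, Prog.eval, ← hs']
      rw [h2.var t ht, e4, add_zero]
      congr 3
      rw [c1.sign t ht, c1.other 4 (by omega) (by omega) (by omega) (by omega), add_zero]
    rw [hev]
    obtain ⟨g1, g2⟩ := countAll_eval (s := ((s'.1.update 2 (V t)).update 3 (S t), s'.2)) c2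
    refine ⟨g1.trans h1, ?_⟩
    rw [List.range_succ, List.map_append]
    convert g2 using 2
    simp

/-- The numerator of the probability of a literal over the denominator `2 * h`. -/
def weightNum (P h N a b : ℕ) : ℕ :=
  if a + b + N * b ≤ N * a then P else if a + b + N * a ≤ N * b then 2 * h - P else h

theorem litWeight_eval (P h N t : ℕ) (s : (ℕ →₀ ℕ) × List ℕ) :
    ((litWeight P h N t).eval s).1 5 = weightNum P h N (s.1 (sameCell t)) (s.1 (oppCell t)) ∧
    ∀ x, (x < 4 ∨ 10 ≤ x) → ((litWeight P h N t).eval s).1 x = s.1 x := by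
  have ha : ∀ y, y < 10 → sameCell t ≠ y := by unfold sameCell; omega
  have hb : ∀ y, y < 10 → oppCell t ≠ y := by unfold oppCell; omega
  simp only [litWeight, Prog.eval, Finsupp.coe_update, Function.update_apply]
  simp only [ha 4 (by omega), ha 5 (by omega), hb 4 (by omega), hb 5 (by omega), hb 6 (by omega),
    if_true, if_false, ne_eq, show (4 : ℕ) ≠ 5 by decide, show (4 : ℕ) ≠ 6 by decide,
    show (4 : ℕ) ≠ 7 by decide, show (4 : ℕ) ≠ 8 by decide, show (5 : ℕ) ≠ 6 by decide,
    show (6 : ℕ) ≠ 7 by decide, show (6 : ℕ) ≠ 8 by decide, show (7 : ℕ) ≠ 8 by decide,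
    show (7 : ℕ) ≠ 9 by decide, show (8 : ℕ) ≠ 9 by decide,
    show (9 : ℕ) ≠ 8 by decide]
  unfold weightNum
  simp only [Nat.sub_eq_zero_iff_le, ite_not]
  refine ⟨?_, fun x hx => ?_⟩
  · split_ifs <;> simp
  · have : ∀ y, 4 ≤ y → y < 10 → x ≠ y := by omega
    split_ifs <;> simp only [Finsupp.coe_update, Function.update_apply, this 4 (by omega) (by omega),
      this 5 (by omega) (by omega), this 6 (by omega) (by omega), this 7 (by omega) (by omega),
      this 8 (by omega) (by omega), this 9 (by omega) (by omega), if_false]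

theorem prodWeight_eval (P h N t₀ l : ℕ) (s : (ℕ →₀ ℕ) × List ℕ) :
    ((prodWeight P h N t₀ l).eval s).1 3 = ∏ i ∈ Finset.range l,
      weightNum P h N (s.1 (sameCell (t₀ + i))) (s.1 (oppCell (t₀ + i))) ∧
    ∀ x, (x < 3 ∨ 10 ≤ x) → ((prodWeight P h N t₀ l).eval s).1 x = s.1 x := by
  induction l with
  | zero =>
    refine ⟨by simp [prodWeight, Prog.eval], fun x hx => ?_⟩
    simp only [prodWeight, Prog.eval, Finsupp.coe_update]
    rw [Function.update_of_ne (by omega)]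
  | succ l ih =>
    obtain ⟨h1, h2⟩ := ih
    obtain ⟨g1, g2⟩ := litWeight_eval P h N (t₀ + l) ((prodWeight P h N t₀ l).eval s)
    refine ⟨?_, fun x hx => ?_⟩
    · simp only [prodWeight, Prog.eval, Finsupp.coe_update, Function.update_self]
      rw [g1, g2 3 (by omega), h1, h2 _ (by unfold sameCell; omega), h2 _ (by unfold oppCell; omega),
        Finset.prod_range_succ]
    · simp only [prodWeight, Prog.eval, Finsupp.coe_update]
      rw [Function.update_of_ne (by omega), g2 x (by omega), h2 x hx]

theorem sumWeight_eval (P h N k T : ℕ) (s : (ℕ →₀ ℕ) × List ℕ) :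
    ((sumWeight P h N k T).eval s).1 0 = (∑ t ∈ Finset.range T, if s.1 (varCell (t * k)) ≠ 0 then
      ∏ i ∈ Finset.range k, weightNum P h N (s.1 (sameCell (t * k + i))) (s.1 (oppCell (t * k + i)))
      else 0) ∧
    ((sumWeight P h N k T).eval s).1 1 = s.1 1 +
      (∑ t ∈ Finset.range T, if s.1 (varCell (t * k)) ≠ 0 then 1 else 0) ∧
    ∀ x, 10 ≤ x → ((sumWeight P h N k T).eval s).1 x = s.1 x := by
  induction T with
  | zero =>
    refine ⟨by simp [sumWeight, Prog.eval], ?_, fun x hx => ?_⟩ <;>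
      simp only [sumWeight, Prog.eval, Finsupp.coe_update] <;>
      rw [Function.update_of_ne (by omega)]
    simp
  | succ T ih =>
    obtain ⟨h1, h2, h3⟩ := ih
    obtain ⟨g1, g2⟩ := prodWeight_eval P h N (T * k) k ((sumWeight P h N k T).eval s)
    have hV : ((sumWeight P h N k T).eval s).1 (varCell (T * k)) = s.1 (varCell (T * k)) :=
      h3 _ (by unfold varCell; omega)
    have hsame : ∀ i, ((sumWeight P h N k T).eval s).1 (sameCell i) = s.1 (sameCell i) :=
      fun i => h3 _ (by unfold sameCell; omega)
    have hopp : ∀ i, ((sumWeight P h N k T).eval s).1 (oppCell i) = s.1 (oppCell i) :=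
      fun i => h3 _ (by unfold oppCell; omega)
    simp only [hsame, hopp] at g1
    rw [Finset.sum_range_succ, Finset.sum_range_succ]
    by_cases hz : s.1 (varCell (T * k)) ≠ 0
    · rw [if_pos hz, if_pos hz]
      have he : ∀ x, ((sumWeight P h N k (T + 1)).eval s).1 x =
          if x = 1 then ((sumWeight P h N k T).eval s).1 1 + 1 else if x = 5 then 1 else
          if x = 0 then ((sumWeight P h N k T).eval s).1 0 +
            ((prodWeight P h N (T * k) k).eval ((sumWeight P h N k T).eval s)).1 3 else
          ((prodWeight P h N (T * k) k).eval ((sumWeight P h N k T).eval s)).1 x := fun x => by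
        simp only [sumWeight, Prog.eval]
        rw [if_pos (by rw [hV]; exact hz)]
        simp only [Finsupp.coe_update, Function.update_apply]
        rw [← g2 1 (by omega), ← g2 0 (by omega)]
        simp
      rw [he, he, if_pos rfl, if_neg (by omega), if_neg (by omega), if_pos rfl, h1, h2, g1]
      refine ⟨rfl, by ring, fun x hx => ?_⟩
      rw [he, if_neg (by omega), if_neg (by omega), if_neg (by omega), g2 x (by omega), h3 x hx]
    · rw [if_neg hz, if_neg hz]
      have he : (sumWeight P h N k (T + 1)).eval s = (sumWeight P h N k T).eval s := by
        simp only [sumWeight, Prog.eval]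
        rw [if_neg (by rw [hV]; exact hz)]
      rw [he]
      exact ⟨h1, h2, h3⟩

theorem writeOutput_eval (D E : ℕ) (s : (ℕ →₀ ℕ) × List ℕ) :
    ((writeOutput D E).eval s).1 0 = s.1 0 * E - s.1 1 * D ∧
      ((writeOutput D E).eval s).1 1 = s.1 1 * D * E := by
  simp [writeOutput, Prog.eval]

/-! ### The run of the algorithm -/

/-- A counter never exceeds the number of literals counted, so the bound is independent of how the
memory came about. -/
theorem Counted.bdd {M n b : ℕ} {V S : ℕ → ℕ} {X : List (ℕ × ℕ)} {R : ℕ →₀ ℕ}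
    (h : Counted M n b V S X R) (hn : n ≤ b) (hV : ∀ t < M, V t ≤ b) (hS : ∀ t < M, S t ≤ b)
    (hX : X.length ≤ b) {w : List ℕ} (hw : ∀ x ∈ w, x ≤ b) : Bdd (10 + 4 * M) b (R, w) := by
  refine ⟨fun i hi => h.other i (by omega) (by omega) (by omega) (by omega), fun i => ?_, hw⟩
  by_cases h0 : i = 0
  · rw [h0]; exact h.zero.le.trans hn
  by_cases h2 : i = 2
  · rw [h2]; exact h.two
  by_cases h3 : i = 3
  · rw [h3]; exact h.three
  by_cases hi : i < 10 ∨ 10 + 4 * M ≤ i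
  · change R i ≤ b
    rw [h.other i h0 h2 h3 hi]; exact Nat.zero_le b
  · obtain ⟨t, ht, hc⟩ : ∃ t < M, i = varCell t ∨ i = signCell t ∨ i = sameCell t ∨ i = oppCell t :=
      ⟨(i - 10) / 4, by omega, by unfold varCell signCell sameCell oppCell; omega⟩
    change R i ≤ b
    rcases hc with rfl | rfl | rfl | rfl
    · rw [h.var t ht]; exact hV t ht
    · rw [h.sign t ht]; exact hS t ht
    · rw [h.same t ht]; exact List.countP_le_length.trans hX
    · rw [h.opp t ht]; exact List.countP_le_length.trans hX

theorem flat_le {b : ℕ} {L : List (ℕ × ℕ)} (hL : ∀ x ∈ L, x.1 ≤ b ∧ x.2 ≤ b) :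
    ∀ x ∈ flat L, x ≤ b := by
  intro x hx
  obtain ⟨y, hy, hxy⟩ := List.mem_flatMap.mp hx
  have := hL y hy
  simp at hxy
  omega

/-! ### The cells and constants of the subprograms -/

theorem simple_countUpTo {A c M : ℕ} (t : ℕ) (ht : t ≤ M) (hA : 10 + 4 * M ≤ A) (hc : 1 ≤ c) :
    (countUpTo t).Simple A c := by
  induction t with
  | zero => trivial
  | succ t ih =>
    refine ⟨ih (by omega), ?_⟩
    simp only [countOne, Prog.Simple, varCell, signCell, sameCell, oppCell, true_and]
    omega

theorem simple_countAll {A c M : ℕ} (hA : 10 + 4 * M ≤ A) (hc : 1 ≤ c) :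
    (countAll M).Simple A c := by
  refine ⟨simple_countUpTo M le_rfl hA hc, ?_⟩
  simp only [Prog.Simple]
  omega

theorem simple_loopBody {A c M : ℕ} (hA : 10 + 4 * M ≤ A) (hc : 1 ≤ c) :
    (loopBody M).Simple A c := by
  refine ⟨?_, simple_countAll hA hc, ?_⟩ <;> simp only [Prog.Simple] <;> omega

theorem simple_prologue {A c M : ℕ} (hA : 10 + 4 * M ≤ A) (hc : 1 ≤ c) :
    (prologue M).Simple A c := by
  have h1 : ∀ t ≤ M, (readLits t).Simple A c := by
    intro t
    induction t with
    | zero => intro _; trivial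
    | succ t ih =>
      intro ht
      refine ⟨ih (by omega), ?_⟩
      simp only [Prog.Simple, varCell, signCell]
      omega
  have h2 : ∀ t ≤ M, (selfCount M t).Simple A c := by
    intro t
    induction t with
    | zero => intro _; trivial
    | succ t ih =>
      intro ht
      refine ⟨ih (by omega), ?_, ?_, simple_countAll hA hc⟩ <;>
        simp only [Prog.Simple, varCell, signCell] <;> omega
  refine ⟨h1 M le_rfl, h2 M le_rfl, ?_⟩
  simp only [Prog.Simple]
  omega

theorem simple_epilogue {A c P h N k T E : ℕ} (hk : 0 < k) (hA : 10 + 4 * (T * k) ≤ A)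
    (hc : 1 + P + 2 * h + N + E + (2 * h) ^ k ≤ c) : (epilogue P h N k T E).Simple A c := by
  have h1 : ∀ t₀ l, t₀ + l ≤ T * k → (prodWeight P h N t₀ l).Simple A c := by
    intro t₀ l
    induction l with
    | zero => intro _; simp only [prodWeight, Prog.Simple]; omega
    | succ l ih =>
      intro hl
      refine ⟨ih (by omega), ?_, ?_⟩
      · simp only [litWeight, Prog.Simple, sameCell, oppCell]
        omega
      · simp only [Prog.Simple]; omega
  have h2 : ∀ t ≤ T, (sumWeight P h N k t).Simple A c := by
    intro t
    induction t with
    | zero => intro _; simp only [sumWeight, Prog.Simple]; omega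
    | succ t ih =>
      intro ht
      have h3 : t * k + k ≤ T * k := by
        calc t * k + k = (t + 1) * k := by ring
          _ ≤ T * k := Nat.mul_le_mul_right k ht
      refine ⟨ih (by omega), ?_, ⟨h1 _ _ h3, ?_⟩, trivial⟩
      · unfold varCell; omega
      · simp only [Prog.Simple]; omega
  refine ⟨h2 T le_rfl, ?_⟩
  simp only [writeOutput, Prog.Simple]
  omega

/-- Induction on the uncounted literals `Y`. One pass through the body could raise the bound to a
power of `b`, but `Counted.bdd` resets it to `b` before the next pass, so nothing accumulates. -/
theorem loop_run {M n b B' : ℕ} {V S : ℕ → ℕ} (hb : 2 ≤ b) (hn : n ≤ b) (hV : ∀ t < M, V t ≤ b)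
    (hS : ∀ t < M, S t ≤ b) (hB' : b ^ 2 ^ (loopBody M).length ≤ B') (K : List Prog)
    (Y : List (ℕ × ℕ)) :
    ∀ (X : List (ℕ × ℕ)) (s : (ℕ →₀ ℕ) × List ℕ), (∀ y ∈ Y, y.1 ≠ 0 ∧ y.1 ≤ b ∧ y.2 ≤ b) →
      X.length + Y.length ≤ b → Counted M n b V S X s.1 → s.1 2 = (flat Y).headD 0 →
      s.2 = (flat Y).tail →
      ∃ s' : (ℕ →₀ ℕ) × List ℕ, BddRun (10 + 4 * M) B' ⟨.loop 2 (loopBody M) :: K, s.1, s.2⟩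
        ⟨K, s'.1, s'.2⟩ ∧ Counted M n b V S (X ++ Y) s'.1 ∧ s'.1 2 = 0 ∧ s'.2 = [] := by
  have hbB : b ≤ B' := (le_pow_two_pow _ _).trans hB'
  induction Y with
  | nil =>
    intro X s _ hlen hc h2 hw
    have hbdd : Bdd (10 + 4 * M) b s :=
      hc.bdd hn hV hS (by simpa using hlen) (by rw [hw]; simp [flat])
    refine ⟨s, .step (hbdd.mono hbB) ?_, by simpa using hc, h2, hw⟩
    have : s.1 2 = 0 := h2
    simp [step, this]
  | cons y Y ih =>
    intro X s hY hlen hc h2 hw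
    obtain ⟨hy0, hy1, hy2⟩ := hY y (by simp)
    have hY' : ∀ y ∈ Y, y.1 ≠ 0 ∧ y.1 ≤ b ∧ y.2 ≤ b := fun z hz => hY z (by simp [hz])
    have hle := flat_le fun x hx => (hY' x hx).2
    have h2 : s.1 2 = y.1 := h2
    have hw : s.2 = y.2 :: flat Y := hw
    have hbdd : Bdd (10 + 4 * M) b s := by
      refine hc.bdd hn hV hS (by simp at hlen; omega) ?_
      rw [hw]
      intro x hx
      rcases List.mem_cons.mp hx with rfl | hx
      · exact hy2
      · exact hle x hx
    have c1 := hc.update (d := 3) (v := y.2) (.inr rfl) hy2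
    obtain ⟨e1, c2⟩ := countAll_eval (s := (s.1.update 3 y.2, flat Y)) c1
    have hhead : (flat Y).headD 0 ≤ b := by
      cases hf : flat Y with
      | nil => simp
      | cons a l => exact hle a (by simp [hf])
    have c3 := c2.update (d := 2) (v := (flat Y).headD 0) (.inl rfl) hhead
    have hev : (loopBody M).eval s =
        (((countAll M).eval (s.1.update 3 y.2, flat Y)).1.update 2 ((flat Y).headD 0),
          (flat Y).tail) := by
      simp only [loopBody, Prog.eval, hw, List.headD_cons, List.tail_cons, e1]
    obtain ⟨r, -⟩ := Prog.Simple.run (loopBody M) (.loop 2 (loopBody M) :: K)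
      (simple_loopBody le_rfl (by omega)) hb hbdd hB'
    have hx : X ++ [((s.1.update 3 y.2) 2, (s.1.update 3 y.2) 3)] = X ++ [y] := by
      have e2 : (s.1.update 3 y.2) 2 = y.1 := by
        rw [Finsupp.coe_update, Function.update_of_ne (by omega), h2]
      have e3 : (s.1.update 3 y.2) 3 = y.2 := by simp
      rw [e2, e3]
    rw [hev] at r
    simp only [hx] at c3
    obtain ⟨s', r', c', h'⟩ := ih (X ++ [y])
      (((countAll M).eval (s.1.update 3 y.2, flat Y)).1.update 2 ((flat Y).headD 0), (flat Y).tail)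
      hY' (by simp at hlen ⊢; omega) c3 (by simp) rfl
    refine ⟨s', (BddRun.step (hbdd.mono hbB) ?_).trans (r.trans r'), by simpa using c', h'⟩
    simp [step, h2, hy0]

theorem countP_range_getD {L : List (ℕ × ℕ)} {p : ℕ × ℕ → Bool} (hp : p (0, 0) = false) (M : ℕ) :
    ((List.range M).map fun i => ((L.getD i (0, 0)).1, (L.getD i (0, 0)).2)).countP p =
      (L.take M).countP p := by
  induction M with
  | zero => simp
  | succ M ih =>
    rw [List.range_succ, List.map_append, List.countP_append, ih, List.take_add_one,
      List.countP_append]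
    congr 1
    rcases lt_or_ge M L.length with h | h
    · simp [h]
    · simp [h, hp]

/-- The algorithm halts on every stream of literals, uses memory cells with polynomially bounded
contents, and outputs the estimate of the value of the oblivious rounding. -/
theorem algorithm_run {P h N k T E n b : ℕ} (hk : 0 < k) (hn : n ≤ b)
    (hb : 1 + P + 2 * h + N + E + (2 * h) ^ k ≤ b) (h2 : 2 ≤ b) {L : List (ℕ × ℕ)}
    (hL : ∀ y ∈ L, y.1 ≠ 0 ∧ y.1 ≤ b ∧ y.2 ≤ b) (hlen : T * k + L.length ≤ b)
    (hfull : ∀ t i, i < k → (L.getD (t * k) (0, 0)).1 ≠ 0 → (L.getD (t * k + i) (0, 0)).1 ≠ 0) :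
    let B := b ^ 2 ^ ((prologue (T * k)).length + (loopBody (T * k)).length +
      (epilogue P h N k T E).length)
    let v := fun t => (L.getD t (0, 0)).1
    let a := fun t => L.countP fun x => x.1 = v t ∧ x.2 = (L.getD t (0, 0)).2
    let a' := fun t => L.countP fun x => x.1 = v t ∧ x.2 ≠ (L.getD t (0, 0)).2
    let D := (2 * h) ^ k
    let c := ∑ t ∈ Finset.range T, if v (t * k) ≠ 0 then 1 else 0
    let w := ∑ t ∈ Finset.range T, if v (t * k) ≠ 0 then
      ∏ i ∈ Finset.range k, weightNum P h N (a (t * k + i)) (a' (t * k + i)) else 0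
    ∃ s : (ℕ →₀ ℕ) × List ℕ,
      BddRun (10 + 4 * (T * k)) B (start (algorithm P h N k T E) n (flat L)) ⟨[], s.1, s.2⟩ ∧
      Bdd (10 + 4 * (T * k)) B s ∧ s.1 0 = w * E - c * D ∧ s.1 1 = c * D * E := by
  intro B v a a' D c w
  set M := T * k with hM
  set V : ℕ → ℕ := fun t => (L.getD t (0, 0)).1 with hV
  set S : ℕ → ℕ := fun t => (L.getD t (0, 0)).2 with hS
  have hget : ∀ t, V t ≤ b ∧ S t ≤ b := by
    intro t
    simp only [hV, hS]
    rcases lt_or_ge t L.length with h | h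
    · rw [List.getD_eq_getElem _ _ h]
      exact (hL _ (List.getElem_mem h)).2
    · rw [List.getD_eq_default _ _ h]
      simp
  have hB1 : b ^ 2 ^ (prologue M).length ≤ B :=
    pow_two_pow_mono h2 ((Nat.le_add_right _ _).trans (Nat.le_add_right _ _))
  have hB2 : b ^ 2 ^ (loopBody M).length ≤ B :=
    pow_two_pow_mono h2 ((Nat.le_add_left _ _).trans (Nat.le_add_right _ _))
  have hB3 : b ^ 2 ^ (epilogue P h N k T E).length ≤ B :=
    pow_two_pow_mono h2 (Nat.le_add_left _ _)
  have hbB : b ≤ B := le_pow_two_pow _ _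
  set s₀ : (ℕ →₀ ℕ) × List ℕ := (Finsupp.single 0 n, flat L) with hs₀
  have hsingle : ∀ x, x ≠ 0 → s₀.1 x = 0 := fun x hx => Finsupp.single_eq_of_ne hx
  have hb₀ : Bdd (10 + 4 * M) b s₀ := by
    refine ⟨fun i hi => hsingle i (by omega), fun i => ?_, flat_le fun x hx => (hL x hx).2⟩
    by_cases hi : i = 0
    · rw [hi]; simpa [hs₀] using hn
    · rw [hsingle i hi]; exact Nat.zero_le b
  obtain ⟨r1, r2, r3⟩ := readLits_eval L M s₀ rfl
  have hc0 : Counted M n b V S [] ((readLits M).eval s₀).1 := by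
    have h0 : ∀ x, (∀ i < M, x ≠ varCell i ∧ x ≠ signCell i) → x ≠ 0 →
        ((readLits M).eval s₀).1 x = 0 := fun x hx hx0 => (r3 x hx).trans (hsingle x hx0)
    refine ⟨?_, ?_, ?_, fun x h0' _ _ hx => ?_, fun t ht => (r2 t ht).1, fun t ht => (r2 t ht).2,
      fun t ht => ?_, fun t ht => ?_⟩
    · rw [r3 0 (by unfold varCell signCell; omega)]; simp [hs₀]
    · rw [h0 2 (by unfold varCell signCell; omega) (by omega)]; exact Nat.zero_le b
    · rw [h0 3 (by unfold varCell signCell; omega) (by omega)]; exact Nat.zero_le b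
    · exact h0 x (by unfold varCell signCell; omega) h0'
    · rw [h0 _ (by unfold varCell signCell sameCell; omega) (by unfold sameCell; omega)]; rfl
    · rw [h0 _ (by unfold varCell signCell oppCell; omega) (by unfold oppCell; omega)]; rfl
  obtain ⟨t1, t2⟩ := selfCount_eval (fun t _ => (hget t).1) (fun t _ => (hget t).2) hc0 M le_rfl
  set X := (List.range M).map fun i => (V i, S i) with hX
  set Y := L.drop M with hY
  have hYL : ∀ y ∈ Y, y.1 ≠ 0 ∧ y.1 ≤ b ∧ y.2 ≤ b := fun y hy => hL y (List.mem_of_mem_drop hy)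
  have hhead : (flat Y).headD 0 ≤ b := by
    have hle := flat_le fun x hx => (hYL x hx).2
    cases hf : flat Y with
    | nil => simp
    | cons a l => exact hle a (by simp [hf])
  set s₁ := (prologue M).eval s₀ with hs₁
  have hs₁' : s₁ = (((selfCount M M).eval ((readLits M).eval s₀)).1.update 2 ((flat Y).headD 0),
      (flat Y).tail) := by
    simp only [hs₁, prologue, Prog.eval, t1, r1]
  have hc1 : Counted M n b V S X s₁.1 := by
    rw [hs₁']
    exact t2.update (.inl rfl) hhead
  have hXlen : X.length + Y.length ≤ b := by
    simp only [hX, hY, List.length_map, List.length_range, List.length_drop]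
    omega
  obtain ⟨run1, -⟩ := Prog.Simple.run (prologue M)
    [.seq (.loop 2 (loopBody M)) (epilogue P h N k T E)] (simple_prologue le_rfl (by omega)) h2 hb₀
    hB1
  obtain ⟨s₂, run2, hc2, e2, hw2⟩ := loop_run h2 hn (fun t _ => (hget t).1) (fun t _ => (hget t).2)
    hB2 [epilogue P h N k T E] Y X s₁ hYL hXlen hc1 (by rw [hs₁']; simp) (by rw [hs₁'])
  have hb₁ : Bdd (10 + 4 * M) b s₁ := by
    refine hc1.bdd hn (fun t _ => (hget t).1) (fun t _ => (hget t).2) (by omega) fun x hx => ?_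
    replace hx : x ∈ s₁.2 := hx
    rw [hs₁'] at hx
    exact flat_le (fun x hx => (hYL x hx).2) x (List.mem_of_mem_tail hx)
  have hb₂ : Bdd (10 + 4 * M) b s₂ :=
    hc2.bdd hn (fun t _ => (hget t).1) (fun t _ => (hget t).2) (by simpa using hXlen)
      (by rw [hw2]; simp)
  obtain ⟨run3, hb₃⟩ := Prog.Simple.run (epilogue P h N k T E) [] (simple_epilogue hk le_rfl hb) h2
    hb₂ hB3
  refine ⟨(epilogue P h N k T E).eval s₂, ?_, hb₃.mono hB3, ?_⟩
  · refine (BddRun.step (hb₀.mono hbB) rfl).trans (run1.trans ?_)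
    exact (BddRun.step (hb₁.mono hbB) rfl).trans (run2.trans run3)
  -- If the stream has fewer than `M` literals, `X` contains padding `(0, 0)`, which such a `p` does
  -- not count.
  have hcount : ∀ p : ℕ × ℕ → Bool, p (0, 0) = false → (X ++ Y).countP p = L.countP p := by
    intro p hp
    rw [List.countP_append, hX, countP_range_getD hp, ← List.countP_append, hY,
      List.take_append_drop]
  have hlt : ∀ t ∈ Finset.range T, ∀ i < k, t * k + i < M := by
    intro t ht i hi
    calc t * k + i < t * k + k := by omega
      _ = (t + 1) * k := by ring
      _ ≤ M := Nat.mul_le_mul_right k (Finset.mem_range.mp ht)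
  obtain ⟨g1, g2, -⟩ := sumWeight_eval P h N k T s₂
  have hv : ∀ t ∈ Finset.range T, s₂.1 (varCell (t * k)) = v (t * k) := fun t ht =>
    hc2.var _ (hlt t ht 0 hk)
  have hw : ((sumWeight P h N k T).eval s₂).1 0 = w := by
    rw [g1]
    refine Finset.sum_congr rfl fun t ht => ?_
    rw [hv t ht]
    by_cases hz : v (t * k) ≠ 0
    · rw [if_pos hz, if_pos hz]
      refine Finset.prod_congr rfl fun i hi => ?_
      have hi := Finset.mem_range.mp hi
      have hne : V (t * k + i) ≠ 0 := hfull t i hi hz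
      rw [hc2.same _ (hlt t ht i hi), hc2.opp _ (hlt t ht i hi), hcount _ (by simp [hne.symm]),
        hcount _ (by simp [hne.symm])]
    · rw [if_neg hz, if_neg hz]
  have hcc : ((sumWeight P h N k T).eval s₂).1 1 = c := by
    rw [g2, hc2.other 1 (by omega) (by omega) (by omega) (by omega), zero_add]
    refine Finset.sum_congr rfl fun t ht => ?_
    rw [hv t ht]
  have hfin := writeOutput_eval D E ((sumWeight P h N k T).eval s₂)
  rw [hw, hcc] at hfin
  exact hfin

/-! ### The stream as a list of literals -/

/-- The literals of a clause in the order of the stream. -/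
def Clause.literals {n k : ℕ} (C : Clause n k) : List (ℕ × ℕ) :=
  ((C.pos ∪ C.neg).sort (· ≤ ·)).map fun v : Fin n => ((v : ℕ) + 1, if v ∈ C.pos then 1 else 0)

/-- The literals of a stream. -/
def literals {n k m : ℕ} (Ψ : Fin m → Clause n k) (σ : Equiv.Perm (Fin m)) : List (ℕ × ℕ) :=
  (List.ofFn fun i => Ψ (σ i)).flatMap Clause.literals

theorem stream_eq {n k m : ℕ} (Ψ : Fin m → Clause n k) (σ : Equiv.Perm (Fin m)) :
    stream Ψ σ = flat (literals Ψ σ) := by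
  rw [stream, flat, literals, List.flatMap_assoc]
  congr 1
  funext C
  rw [Clause.encode, Clause.literals, List.flatMap_map]

theorem Clause.length_literals {n k : ℕ} (C : Clause n k) : C.literals.length = k := by
  rw [Clause.literals, List.length_map, Finset.length_sort, C.card_eq]

theorem length_literals {n k m : ℕ} (Ψ : Fin m → Clause n k) (σ : Equiv.Perm (Fin m)) :
    (literals Ψ σ).length = m * k := by
  simp [literals, List.length_flatMap, Function.comp_def, Clause.length_literals]

theorem Clause.mem_literals {n k : ℕ} {C : Clause n k} {x : ℕ × ℕ} (hx : x ∈ C.literals) :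
    x.1 ≠ 0 ∧ x.1 ≤ n ∧ x.2 ≤ 1 := by
  obtain ⟨v, -, rfl⟩ := List.mem_map.mp hx
  refine ⟨by simp, v.isLt, ?_⟩
  simp only
  split_ifs <;> simp

theorem mem_literals {n k m : ℕ} {Ψ : Fin m → Clause n k} {σ : Equiv.Perm (Fin m)} {x : ℕ × ℕ}
    (hx : x ∈ literals Ψ σ) : x.1 ≠ 0 ∧ x.1 ≤ n ∧ x.2 ≤ 1 := by
  obtain ⟨C, -, hC⟩ := List.mem_flatMap.mp hx
  exact Clause.mem_literals hC

/-- A variable occurs at most once in a clause. The predicate is constrained only for signs `0` and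
`1`, so that "a different sign" may stand for "the opposite sign". -/
theorem Clause.countP_literals {n k : ℕ} (C : Clause n k) (v : Fin n) (s : Bool)
    (p : ℕ × ℕ → Bool) (hp : ∀ x : ℕ × ℕ, x.2 ≤ 1 → (p x = true ↔ x.1 = v + 1 ∧ x.2 = s.toNat)) :
    C.literals.countP p = if v ∈ C.lits s then 1 else 0 := by
  have h1 : C.literals.countP p = ((C.pos ∪ C.neg).filter fun u : Fin n =>
      p ((u : ℕ) + 1, if u ∈ C.pos then 1 else 0) = true).card := by
    rw [Clause.literals, List.countP_map, Finset.card_def, Finset.filter_val,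
      ← Finset.sort_eq (C.pos ∪ C.neg) (· ≤ ·), Multiset.filter_coe, Multiset.coe_card,
      List.countP_eq_length_filter]
    simp [Function.comp_def]
  have h2 : ((C.pos ∪ C.neg).filter fun u : Fin n => p ((u : ℕ) + 1, if u ∈ C.pos then 1 else 0) = true) =
      if v ∈ C.lits s then {v} else ∅ := by
    ext u
    have hu : (if u ∈ C.pos then 1 else 0) ≤ 1 := by split_ifs <;> omega
    rw [Finset.mem_filter, hp _ hu]
    by_cases huv : u = v
    · subst huv
      have hd : u ∈ C.neg → u ∉ C.pos := fun h => Finset.disjoint_right.mp C.disjoint h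
      cases s
      · by_cases h : u ∈ C.neg
        · simp [Clause.lits, h, hd h]
        · simp [Clause.lits, h]
      · by_cases h : u ∈ C.pos <;> simp [Clause.lits, h]
    · have : (u : ℕ) ≠ v := fun h => huv (Fin.ext h)
      split_ifs <;> simp [huv, this]
  rw [h1, h2]
  split_ifs <;> simp

theorem countP_literals {n k m : ℕ} (Ψ : Fin m → Clause n k) (σ : Equiv.Perm (Fin m)) (v : Fin n)
    (s : Bool) (p : ℕ × ℕ → Bool)
    (hp : ∀ x : ℕ × ℕ, x.2 ≤ 1 → (p x = true ↔ x.1 = v + 1 ∧ x.2 = s.toNat)) :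
    (literals Ψ σ).countP p = occ Ψ v s := by
  rw [literals, List.countP_flatMap, List.map_ofFn, List.sum_ofFn, occ, Finset.card_filter,
    ← Equiv.sum_comp σ fun j => if v ∈ (Ψ j).lits s then 1 else 0]
  exact Finset.sum_congr rfl fun i _ => (Ψ (σ i)).countP_literals v s p hp

theorem getElem?_flatMap {α β : Type*} {k : ℕ} (f : α → List β) (hf : ∀ x, (f x).length = k)
    (l : List α) (t i : ℕ) (hi : i < k) :
    (l.flatMap f)[t * k + i]? = l[t]?.bind fun x => (f x)[i]? := by
  induction l generalizing t with
  | nil => simp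
  | cons a l ih =>
    rw [List.flatMap_cons]
    cases t with
    | zero =>
      rw [List.getElem?_append_left (by rw [hf]; omega)]
      simp
    | succ t =>
      have e : (t + 1) * k + i = (f a).length + (t * k + i) := by rw [hf]; ring
      rw [e, List.getElem?_append_right (by omega), Nat.add_sub_cancel_left, ih t]
      simp

theorem getD_literals {n k m : ℕ} (Ψ : Fin m → Clause n k) (σ : Equiv.Perm (Fin m)) (t i : ℕ)
    (hi : i < k) : (literals Ψ σ).getD (t * k + i) (0, 0) =
      if ht : t < m then (Ψ (σ ⟨t, ht⟩)).literals.getD i (0, 0) else (0, 0) := by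
  rw [List.getD_eq_getElem?_getD, literals,
    getElem?_flatMap _ (fun C => C.length_literals) _ _ _ hi, List.getElem?_ofFn]
  split_ifs with h
  · simp [List.getD_eq_getElem?_getD]
  · simp

theorem Clause.getD_literals {n k : ℕ} (C : Clause n k) {i : ℕ} (hi : i < k) :
    (C.literals.getD i (0, 0)).1 ≠ 0 := by
  rw [List.getD_eq_getElem _ _ (by rwa [C.length_literals])]
  exact (Clause.mem_literals (List.getElem_mem _)).1

theorem prod_range_getD {α : Type*} (l : List α) (d : α) (g : α → ℝ) :
    ∏ i ∈ Finset.range l.length, g (l.getD i d) = (l.map g).prod := by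
  induction l with
  | nil => simp
  | cons a l ih =>
    rw [List.length_cons, Finset.prod_range_succ', List.map_cons, List.prod_cons, ← ih, mul_comm]
    simp

theorem Clause.prod_literals {n k : ℕ} (C : Clause n k) (g : ℕ × ℕ → ℝ) :
    ∏ i ∈ Finset.range k, g (C.literals.getD i (0, 0)) =
      ∏ v ∈ C.pos ∪ C.neg, g ((v : ℕ) + 1, if v ∈ C.pos then 1 else 0) := by
  have := prod_range_getD C.literals (0, 0) g
  rw [C.length_literals] at this
  rw [this, Clause.literals, List.map_map, Finset.prod, ← Finset.sort_eq (C.pos ∪ C.neg) (· ≤ ·),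
    Multiset.map_coe, Multiset.prod_coe]
  rfl

theorem weightNum_div {P h N : ℕ} (hh : 0 < h) (hP : P ≤ 2 * h) (a b : ℕ) :
    (weightNum P h N a b : ℝ) = (2 * h : ℕ) * litProb ((P : ℝ) / (2 * h : ℕ)) N a b := by
  have hh' : (h : ℝ) ≠ 0 := by positivity
  unfold weightNum litProb
  split_ifs
  · push_cast; field_simp
  · rw [Nat.cast_sub hP]; push_cast; field_simp
  · push_cast; field_simp

theorem sum_range_dite {m T : ℕ} (G : Fin m → ℝ) :
    ∑ t ∈ Finset.range T, (if h : t < m then G ⟨t, h⟩ else 0) = ∑ i with i.val < T, G i := by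
  rw [Finset.sum_filter, Finset.sum_fin_eq_sum_range]
  have h1 : ∑ t ∈ Finset.range T, (if h : t < m then G ⟨t, h⟩ else 0) =
      ∑ t ∈ (Finset.range T).filter (· < m), if h : t < m then G ⟨t, h⟩ else 0 := by
    rw [Finset.sum_filter]
    refine Finset.sum_congr rfl fun t _ => ?_
    split_ifs <;> rfl
  have h2 : ∑ t ∈ Finset.range m, (if h : t < m then if (⟨t, h⟩ : Fin m).val < T then G ⟨t, h⟩ else 0
      else 0) = ∑ t ∈ (Finset.range m).filter (· < T), if h : t < m then G ⟨t, h⟩ else 0 := by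
    rw [Finset.sum_filter]
    refine Finset.sum_congr rfl fun t _ => ?_
    split_ifs <;> rfl
  have h3 : (Finset.range T).filter (· < m) = (Finset.range m).filter (· < T) := by
    ext t; simp [and_comm]
  rw [h1, h2, h3]

/-- Each of the `k` factors of a clause carries the denominator `2h`, so the machine computes
exactly, in integers. -/
theorem sum_weight_eq {n k m T P h N : ℕ} (hk : 0 < k) (hh : 0 < h) (hP : P ≤ 2 * h)
    (Ψ : Fin m → Clause n k) (σ : Equiv.Perm (Fin m)) :
    let L := literals Ψ σ
    let v := fun t => (L.getD t (0, 0)).1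
    let a := fun t => L.countP fun x => x.1 = v t ∧ x.2 = (L.getD t (0, 0)).2
    let a' := fun t => L.countP fun x => x.1 = v t ∧ x.2 ≠ (L.getD t (0, 0)).2
    ((∑ t ∈ Finset.range T, if v (t * k) ≠ 0 then
      ∏ i ∈ Finset.range k, weightNum P h N (a (t * k + i)) (a' (t * k + i)) else 0 : ℕ) : ℝ) =
    ((2 * h : ℕ) : ℝ) ^ k *
      ∑ i with i.val < T, satProb (obl ((P : ℝ) / (2 * h : ℕ)) N Ψ) (Ψ (σ i)) := by
  intro L v a a'
  set p := (P : ℝ) / (2 * h : ℕ) with hp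
  have hv : ∀ t, v (t * k) ≠ 0 ↔ t < m := by
    intro t
    have := getD_literals Ψ σ t 0 hk
    rw [add_zero] at this
    simp only [v, L, this]
    split_ifs with ht
    · simpa [ht] using Clause.getD_literals _ hk
    · simpa using ht
  rw [← sum_range_dite fun i => satProb (obl p N Ψ) (Ψ (σ i)), Finset.mul_sum, Nat.cast_sum]
  refine Finset.sum_congr rfl fun t _ => ?_
  by_cases ht : t < m
  · rw [if_pos ((hv t).mpr ht), dif_pos ht, Nat.cast_prod]
    set C := Ψ (σ ⟨t, ht⟩) with hC
    set g : ℕ × ℕ → ℝ := fun y => weightNum P h N (L.countP fun x => x.1 = y.1 ∧ x.2 = y.2)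
      (L.countP fun x => x.1 = y.1 ∧ x.2 ≠ y.2) with hg
    have h1 : ∀ i ∈ Finset.range k, (weightNum P h N (a (t * k + i)) (a' (t * k + i)) : ℝ) =
        g (C.literals.getD i (0, 0)) := by
      intro i hi
      have := getD_literals Ψ σ t i (Finset.mem_range.mp hi)
      rw [dif_pos ht] at this
      simp only [a, a', v, hg, L, this, hC]
    rw [Finset.prod_congr rfl h1, C.prod_literals g, satProb_obl]
    have h2 : ∀ u ∈ C.pos ∪ C.neg, g ((u : ℕ) + 1, if u ∈ C.pos then 1 else 0) =
        ((2 * h : ℕ) : ℝ) * litProb p N (occ Ψ u (decide (u ∈ C.pos)))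
          (occ Ψ u (!decide (u ∈ C.pos))) := by
      intro u _
      simp only [hg]
      rw [weightNum_div hh hP, countP_literals Ψ σ u (decide (u ∈ C.pos)),
        countP_literals Ψ σ u (!decide (u ∈ C.pos))]
      · intro x hx
        by_cases hu : u ∈ C.pos
        · simp [hu]; omega
        · simp [hu]; omega
      · intro x hx
        by_cases hu : u ∈ C.pos <;> simp [hu]
    rw [Finset.prod_congr rfl h2, Finset.prod_mul_distrib, Finset.prod_const, C.card_eq]
  · rw [if_neg (fun h => ht ((hv t).mp h)), dif_neg ht]
    simp

theorem sum_count_eq {n k m T : ℕ} (hk : 0 < k) (Ψ : Fin m → Clause n k) (σ : Equiv.Perm (Fin m)) :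
    (∑ t ∈ Finset.range T, if ((literals Ψ σ).getD (t * k) (0, 0)).1 ≠ 0 then 1 else 0) =
      min m T := by
  have hv : ∀ t, ((literals Ψ σ).getD (t * k) (0, 0)).1 ≠ 0 ↔ t < m := by
    intro t
    have := getD_literals Ψ σ t 0 hk
    rw [add_zero] at this
    rw [this]
    split_ifs with ht
    · simpa [ht] using Clause.getD_literals _ hk
    · simpa using ht
  simp_rw [hv]
  rw [← Finset.card_filter]
  have : (Finset.range T).filter (· < m) = Finset.range (min m T) := by
    ext t; simp [and_comm]
  rw [this, Finset.card_range]

theorem literals_full {n k m : ℕ} (hk : 0 < k) (Ψ : Fin m → Clause n k) (σ : Equiv.Perm (Fin m))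
    (t i : ℕ) (hi : i < k) (h : ((literals Ψ σ).getD (t * k) (0, 0)).1 ≠ 0) :
    ((literals Ψ σ).getD (t * k + i) (0, 0)).1 ≠ 0 := by
  have := getD_literals Ψ σ t 0 hk
  rw [add_zero] at this
  rw [this] at h
  rw [getD_literals Ψ σ t i hi]
  by_cases ht : t < m
  · rw [dif_pos ht]; exact Clause.getD_literals _ hi
  · rw [dif_neg ht] at h; exact absurd rfl h

/-! ### The main theorem -/

theorem satProb_mem {n k : ℕ} {f : Fin n → ℝ} (h : ∀ v, 0 ≤ f v ∧ f v ≤ 1) (C : Clause n k) :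
    0 ≤ satProb f C ∧ satProb f C ≤ 1 := by
  have h1 : 0 ≤ ∏ v ∈ C.pos, f v := Finset.prod_nonneg fun v _ => (h v).1
  have h2 : ∏ v ∈ C.pos, f v ≤ 1 := Finset.prod_le_one (fun v _ => (h v).1) fun v _ => (h v).2
  have h3 : 0 ≤ ∏ v ∈ C.neg, (1 - f v) := Finset.prod_nonneg fun v _ => by linarith [(h v).2]
  have h4 : ∏ v ∈ C.neg, (1 - f v) ≤ 1 :=
    Finset.prod_le_one (fun v _ => by linarith [(h v).2]) fun v _ => by linarith [(h v).1]
  exact ⟨mul_nonneg h1 h3, mul_le_one₀ h2 h3 h4⟩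

/-- The space and the output of the algorithm. -/
theorem algorithm_spec {k P h N T E : ℕ} (hk : 2 ≤ k) (hh : 0 < h) (hP : P ≤ 2 * h) (hT : 0 < T)
    (hE : 0 < E) (d : ℕ) : ∃ C : ℝ, ∀ n m : ℕ, 0 < m → m ≤ n ^ d → ∀ Ψ : Fin m → Clause n k,
      ∀ σ : Equiv.Perm (Fin m),
        RunsInSpace (algorithm P h N k T E) n (stream Ψ σ) (C * Real.log n) ∧
        HaltsWithOutput (algorithm P h N k T E) n (stream Ψ σ)
          (max 0 ((∑ i with i.val < T, satProb (obl ((P : ℝ) / (2 * h : ℕ)) N Ψ) (Ψ (σ i))) /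
            (min m T : ℕ) - 1 / E)) := by
  set c₀ := 1 + P + 2 * h + N + E + (2 * h) ^ k with hc₀
  -- Since `x < n^x` for `n ≥ 2`, all constants are absorbed into the exponent: `n^e₀` bounds `n`,
  -- the constants of the program and the number of literals.
  set e₀ := d + (T * k + k) + c₀ + 1 with he₀
  set len := (prologue (T * k)).length + (loopBody (T * k)).length +
    (epilogue P h N k T E).length with hlen
  obtain ⟨C, hC⟩ := exists_space_bound (10 + 4 * (T * k)) (e₀ * 2 ^ len)
  refine ⟨C, fun n m hm hmn Ψ σ => ?_⟩
  -- A clause has `k ≥ 2` distinct variables.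
  have hn : 2 ≤ n := by
    have h1 := (Ψ ⟨0, hm⟩).card_eq
    have h2 := Finset.card_le_univ ((Ψ ⟨0, hm⟩).pos ∪ (Ψ ⟨0, hm⟩).neg)
    rw [Fintype.card_fin] at h2
    omega
  have hpow : ∀ x, x < n ^ x := fun x => Nat.lt_pow_self (by omega)
  have hpos : ∀ x, 0 < n ^ x := fun x => by positivity
  have hmono : ∀ x, x ≤ e₀ → n ^ x ≤ n ^ e₀ := fun x hx => Nat.pow_le_pow_right (by omega) hx
  have hnb : n ≤ n ^ e₀ := by simpa using hmono 1 (by omega)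
  have hcb : c₀ ≤ n ^ e₀ := (hpow c₀).le.trans (hmono c₀ (by omega))
  have hLb : T * k + (literals Ψ σ).length ≤ n ^ e₀ := by
    rw [length_literals]
    calc T * k + m * k ≤ n ^ d * (T * k + k) := by
          have h1 : m * k ≤ n ^ d * k := Nat.mul_le_mul_right k hmn
          have h2 : T * k ≤ n ^ d * (T * k) := Nat.le_mul_of_pos_left _ (hpos d)
          rw [mul_add]; omega
      _ ≤ n ^ d * n ^ (T * k + k) := Nat.mul_le_mul_left _ (hpow _).le
      _ = n ^ (d + (T * k + k)) := (pow_add _ _ _).symm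
      _ ≤ n ^ e₀ := hmono _ (by omega)
  obtain ⟨s, hrun, hbdd, h0, h1⟩ := algorithm_run (P := P) (h := h) (N := N) (k := k) (T := T)
    (E := E) (n := n) (b := n ^ e₀) (by omega) hnb hcb (by omega)
    (L := literals Ψ σ) (fun y hy => by
      have := mem_literals hy
      exact ⟨this.1, by omega, by omega⟩) hLb (literals_full (by omega) Ψ σ)
  rw [← stream_eq] at hrun
  refine ⟨runsInSpace_of_bddRun hrun hbdd ?_, ?_⟩
  · rw [← pow_mul]
    exact hC n hn
  convert haltsWithOutput_of_bddRun hrun using 1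
  have hw := sum_weight_eq (T := T) (N := N) (by omega : 0 < k) hh hP Ψ σ
  have hc := sum_count_eq (T := T) (by omega : 0 < k) Ψ σ
  rw [h0, h1]
  simp only at hw hc ⊢
  rw [hc]
  set w := ∑ t ∈ Finset.range T, if ((literals Ψ σ).getD (t * k) (0, 0)).1 ≠ 0 then
      ∏ i ∈ Finset.range k, weightNum P h N
        ((literals Ψ σ).countP fun x => x.1 = ((literals Ψ σ).getD (t * k + i) (0, 0)).1 ∧
          x.2 = ((literals Ψ σ).getD (t * k + i) (0, 0)).2)
        ((literals Ψ σ).countP fun x => x.1 = ((literals Ψ σ).getD (t * k + i) (0, 0)).1 ∧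
          x.2 ≠ ((literals Ψ σ).getD (t * k + i) (0, 0)).2) else 0
  set S := ∑ i with i.val < T, satProb (obl ((P : ℝ) / (2 * h : ℕ)) N Ψ) (Ψ (σ i))
  set c := min m T
  have hcpos : (0 : ℝ) < c := by exact_mod_cast lt_min hm hT
  have hDpos : (0 : ℝ) < ((2 * h : ℕ) : ℝ) ^ k := by positivity
  have hEpos : (0 : ℝ) < E := by exact_mod_cast hE
  -- The truncated subtraction of the machine is the positive part.
  have hcast : ((w * E - c * (2 * h) ^ k : ℕ) : ℝ) = max 0 ((w : ℝ) * E - c * ((2 * h : ℕ) : ℝ) ^ k) := by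
    rcases le_total (c * (2 * h) ^ k) (w * E) with hle | hle
    · have : (c : ℝ) * ((2 * h : ℕ) : ℝ) ^ k ≤ w * E := by exact_mod_cast hle
      rw [Nat.cast_sub hle, max_eq_right (by linarith)]
      push_cast; ring
    · have : (w : ℝ) * E ≤ c * ((2 * h : ℕ) : ℝ) ^ k := by exact_mod_cast hle
      rw [Nat.sub_eq_zero_of_le hle, max_eq_left (by linarith), Nat.cast_zero]
  rw [hcast, hw]
  push_cast
  push_cast at hDpos
  rw [← max_div_div_right (by positivity : (0 : ℝ) ≤ c * (2 * h : ℝ) ^ k * E), zero_div]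
  congr 1
  have hD0 := hDpos.ne'
  generalize ((2 : ℝ) * h) ^ k = D at *
  field_simp

end MaxKAnd

theorem theorem3 (k : ℕ) (hk : 2 ≤ k) :
    ∃ α : ℝ, MaxKAnd.alphaStar k < α ∧ ∀ ε : ℝ, 0 < ε →
      ∃ P : MaxKAnd.Prog, ∀ d : ℕ, ∃ C : ℝ, ∀ n m : ℕ, 0 < m → m ≤ n ^ d →
        ∀ Ψ : Fin m → MaxKAnd.Clause n k,
          (∀ σ : Equiv.Perm (Fin m),
            (∃ q : ℝ, MaxKAnd.HaltsWithOutput P n (MaxKAnd.stream Ψ σ) q) ∧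
            MaxKAnd.RunsInSpace P n (MaxKAnd.stream Ψ σ) (C * Real.log n)) ∧
          99 / 100 ≤ MaxKAnd.permProb m {σ | ∃ q : ℝ,
            MaxKAnd.HaltsWithOutput P n (MaxKAnd.stream Ψ σ) q ∧
            MaxKAnd.IsApprox (α - ε) (MaxKAnd.value Ψ) q} := by
  obtain ⟨P, h, N, l, μ, α, hh, hP, hα, hdual⟩ := MaxKAnd.exists_dualFeasible k hk
  refine ⟨α, hα, fun ε hε => ?_⟩
  -- The sampling error is at most `1/E`, and the output is lowered by another `1/E` so as not to
  -- exceed the value. The total loss `2/E` is at most `ε 2^{-k}`, hence at most `ε` times the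
  -- value.
  obtain ⟨E, hE⟩ := exists_nat_gt (2 * 2 ^ k / ε)
  have hER : (0 : ℝ) < E := lt_trans (by positivity) hE
  have hE0 : 0 < E := by exact_mod_cast hER
  -- With `T = 100 E^2` and `δ = 1/E`, the failure probability `1 / (T δ^2)` is `1/100`.
  have hT0 : 0 < 100 * E ^ 2 := by positivity
  refine ⟨MaxKAnd.algorithm P h N k (100 * E ^ 2) E, fun d => ?_⟩
  obtain ⟨C, hC⟩ := MaxKAnd.algorithm_spec (N := N) hk hh hP hT0 hE0 d
  refine ⟨C, fun n m hm hmn Ψ => ⟨fun σ => ?_, ?_⟩⟩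
  · obtain ⟨h1, h2⟩ := hC n m hm hmn Ψ σ
    exact ⟨⟨_, h2⟩, h1⟩
  set p := (P : ℝ) / (2 * h : ℕ) with hp
  have hmem : ∀ v, 0 ≤ MaxKAnd.obl p N Ψ v ∧ MaxKAnd.obl p N Ψ v ≤ 1 := fun v =>
    MaxKAnd.litProb_mem (by linarith [hdual.half_le]) hdual.le_one _ _ _
  have hup := MaxKAnd.mean_satProb_le_value _ (fun v => (hmem v).1) (fun v => (hmem v).2) Ψ
  have hlow := hdual.mul_value_le Ψ
  have hval := MaxKAnd.one_div_two_pow_le_value hm Ψ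
  have hεE : 2 / (E : ℝ) ≤ ε * MaxKAnd.value Ψ := by
    have h1 : 2 * 2 ^ k < E * ε := (div_lt_iff₀ hε).mp hE
    calc 2 / (E : ℝ) ≤ ε * (1 / 2 ^ k) := by
          rw [mul_one_div, div_le_div_iff₀ hER (by positivity)]
          linarith
      _ ≤ _ := mul_le_mul_of_nonneg_left hval hε.le
  have hprob := MaxKAnd.sampling hm hT0 (fun j => MaxKAnd.satProb (MaxKAnd.obl p N Ψ) (Ψ j))
    (fun j => (MaxKAnd.satProb_mem hmem _).1) (fun j => (MaxKAnd.satProb_mem hmem _).2)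
    (δ := 1 / E) (by positivity) (E := {σ | ∃ q : ℝ,
      MaxKAnd.HaltsWithOutput (MaxKAnd.algorithm P h N k (100 * E ^ 2) E) n (MaxKAnd.stream Ψ σ) q ∧
      MaxKAnd.IsApprox (α - ε) (MaxKAnd.value Ψ) q}) (by
      intro σ hσ
      refine ⟨_, (hC n m hm hmn Ψ σ).2, ?_, ?_⟩
      · refine le_trans ?_ (le_max_right _ _)
        have := (abs_le.mp hσ).1
        have h2 : 2 / (E : ℝ) = 1 / E + 1 / E := by ring
        linarith
      · refine max_le (le_trans (by positivity) hval) ?_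
        have := (abs_le.mp hσ).2
        linarith)
  have hnum : 1 - 1 / (((100 * E ^ 2 : ℕ) : ℝ) * (1 / E) ^ 2) = 99 / 100 := by
    push_cast
    field_simp
    norm_num
  rw [hnum] at hprob
  exact hprob
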